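/- Let $p\ge 2$, $q\ge 1$ be integers, $\sigma\in\mathbb C$, $\alpha\in\mathbb R$. Write $k=(u,v)\in\mathbb R^{q}\times\mathbb R^{p}$ and let $g_\alpha\in SO_0(p,q)$ be the hyperbolic rotation by $\alpha$ in the plane of the first coordinate axes of $\mathbb R^q$ and $\mathbb R^p$, i.e. $u_1\mapsto u_1\cosh\alpha+v_1\sinh\alpha$, $v_1\mapsto v_1\cosh\alpha+u_1\sinh\alpha$, the other coordinates being fixed. Let $(T(g)F)(k)=F(g^{-1}k)$ act on the even functions, homogeneous of degree $\sigma$, on the cone $|u|=|v|\neq0$, let $F_0(u,v)=|u|^\sigma$ be the $SO(p)\times SO(q)$-invariant vector, and let $(F_1,F_2)$ be the integral of $F_1\overline{F_2}$ over $S^{q-1}\times S^{p-1}$ with respect to the product of the normalized rotation invariant measures. The zonal spherical function of $SO_0(p,q)$ is $Z_\sigma^{[p,q]}(\alpha)=(T(g_\alpha)F_0,F_0)$. Put $\Lambda(\alpha;x,y)=1+(x^2+y^2)\sinh^2\alpha-2xy\sinh\alpha\cosh\alpha$. Then: 1. (Integral representations.) If $p,q\ge3$, $$Z_\sigma^{[p,q]}(\alpha)=\frac{\Gamma(\frac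 p2)\Gamma(\frac q2)}{\pi\,\Gamma(\frac{p-1}2)\Gamma(\frac{q-1}2)}\int_{-1}^{1}\!\int_{-1}^{1}\Lambda(\alpha;x,y)^{\sigma/2}(1-x^2)^{\frac{p-3}2}(1-y^2)^{\frac{q-3}2}\,dx\,dy;$$ if $p\ge3$, $$Z_\sigma^{[p,2]}(\alpha)=\frac{\Gamma(\frac p2)}{2\pi^{3/2}\,\Gamma(\frac{p-1}2)}\int_0^{2\pi}\!\int_{-1}^{1}\Lambda(\alpha;x,\cos\phi)^{\sigma/2}(1-x^2)^{\frac{p-3}2}\,dx\,d\phi;$$ and $$Z_\sigma^{[2,2]}(\alpha)=\frac1{4\pi^2}\int_0^{2\pi}\!\int_0^{2\pi}\Lambda(\alpha;\cos\chi,\cos\phi)^{\sigma/2}\,d\chi\,d\phi.$$ 2. (Horn series.) With $(a)_n=a(a+1)\cdots(a+n-1)$, for every real $\alpha$ the following two double series converge absolutely and $$Z_\sigma^{[p,q]}(\alpha)=\frac1{\cosh\alpha}\sum_{m,n=0}^\infty\frac{(-\frac\sigma2)_m\,(1-\frac{\sigma+q}2)_m\,(\frac{\sigma+q}2)_n\,(\frac12)_{m+n}}{(\frac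 q2)_{m+n}\,(\frac p2)_m}\,\frac{(\tanh^2\alpha)^{m}(\tanh^2\alpha)^{n}}{m!\,n!},$$ $$Z_\sigma^{[p,q]}(\alpha)=\frac1{\cosh\alpha}\sum_{m,n=0}^\infty\frac{(-\frac\sigma2)_m\,(1-\frac{\sigma+p}2)_m\,(\frac{\sigma+p}2)_n\,(\frac12)_{m+n}}{(\frac p2)_{m+n}\,(\frac q2)_m}\,\frac{(\tanh^2\alpha)^{m}(\tanh^2\alpha)^{n}}{m!\,n!}.$$ 3. (Symmetry.) $Z_\sigma^{[p,q]}(\alpha)=Z_\sigma^{[q,p]}(\alpha)$. 4. (The case $q=1$.) $Z_\sigma^{[p,1]}(\alpha)={}_2F_1\!\left(-\frac\sigma2,\frac{1-\sigma}2;\frac p2;\tanh^2\alpha\right)(\cosh\alpha)^\sigma$. -/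

import Mathlib

open MeasureTheory

noncomputable section

/-- The space `ℝ^{p+q}`, written as pairs `k = (u, v)` with `u ∈ ℝ^q` and `v ∈ ℝ^p`. -/
abbrev PseudoSpace (p q : ℕ) : Type :=
  EuclideanSpace ℝ (Fin q) × EuclideanSpace ℝ (Fin p)

/-- The quadratic form `[k, k] = |u|² - |v|²` of signature `(q, p)`. -/
def pseudoForm {p q : ℕ} (k : PseudoSpace p q) : ℝ := ‖k.1‖ ^ 2 - ‖k.2‖ ^ 2

/-- The hyperbolic rotation `g_α` by `α` in the plane spanned by the first coordinate axis of `ℝ^q`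
and the first coordinate axis of `ℝ^p`; its inverse is the hyperbolic rotation by `-α`. -/
def hyperbolicRotation (p q : ℕ) [NeZero p] [NeZero q] (α : ℝ) :
    PseudoSpace p q ≃ₗ[ℝ] PseudoSpace p q where
  toFun k :=
    (k.1 + EuclideanSpace.single 0 ((Real.cosh α - 1) * k.1 0 + Real.sinh α * k.2 0),
     k.2 + EuclideanSpace.single 0 ((Real.cosh α - 1) * k.2 0 + Real.sinh α * k.1 0))
  invFun k :=
    (k.1 + EuclideanSpace.single 0 ((Real.cosh α - 1) * k.1 0 - Real.sinh α * k.2 0),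
     k.2 + EuclideanSpace.single 0 ((Real.cosh α - 1) * k.2 0 - Real.sinh α * k.1 0))
  map_add' k l := by
    ext i <;> by_cases hi : i = 0 <;> simp [hi] <;> ring
  map_smul' c k := by
    ext i <;> by_cases hi : i = 0 <;> simp [hi] <;> ring
  left_inv k := by
    have h := Real.cosh_sq α
    ext i <;> by_cases hi : i = 0 <;> simp [hi]
    · linear_combination (k.1 0) * h
    · linear_combination (k.2 0) * h
  right_inv k := by
    have h := Real.cosh_sq α
    ext i <;> by_cases hi : i = 0 <;> simp [hi]
    · linear_combination (k.1 0) * h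
    · linear_combination (k.2 0) * h

/-- Hyperbolic rotations preserve the form `[k, k]`. -/
theorem pseudoForm_hyperbolicRotation {p q : ℕ} [NeZero p] [NeZero q] (α : ℝ)
    (k : PseudoSpace p q) : pseudoForm (hyperbolicRotation p q α k) = pseudoForm k := by
  have key : ∀ {n : ℕ} [NeZero n] (u : EuclideanSpace ℝ (Fin n)) (c : ℝ),
      ‖u + EuclideanSpace.single 0 c‖ ^ 2 = ‖u‖ ^ 2 + 2 * (c * u 0) + c ^ 2 := by
    intro n _ u c
    rw [norm_add_sq_real, EuclideanSpace.inner_single_right]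
    simp
  have h := Real.cosh_sq α
  simp only [pseudoForm, hyperbolicRotation, LinearEquiv.coe_mk, LinearMap.coe_mk, AddHom.coe_mk,
    key]
  linear_combination ((k.1 0) ^ 2 - (k.2 0) ^ 2) * h

/-- The action `(T(g) F)(k) = F(g⁻¹ k)` on functions of `k`. -/
def pseudoAction {p q : ℕ} (g : PseudoSpace p q ≃ₗ[ℝ] PseudoSpace p q) (F : PseudoSpace p q → ℂ) :
    PseudoSpace p q → ℂ := fun k => F (g.symm k)

/-- The even function `F(k) = ω^σ`, where `ω = |u| = |v|` on the cone `[k, k] = 0`: homogeneous of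
degree `σ`, invariant under `SO(p) × SO(q)`, and equal to `1` on the section `ω = 1`. -/
def zonalVector (p q : ℕ) (σ : ℂ) : PseudoSpace p q → ℂ := fun k => (‖k.1‖ : ℂ) ^ σ

/-- The scalar product over the section `S^{q-1} × S^{p-1}` (`ω = 1`) of the cone, with respect to
the product of the rotation invariant measures, normalized to total mass one. -/
def sectionInner {p q : ℕ} (F₁ F₂ : PseudoSpace p q → ℂ) : ℂ :=
  ⨍ k : Metric.sphere (0 : EuclideanSpace ℝ (Fin q)) 1 ×
      Metric.sphere (0 : EuclideanSpace ℝ (Fin p)) 1,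
    F₁ (k.1, k.2) * (starRingEnd ℂ) (F₂ (k.1, k.2))
      ∂((volume : Measure (EuclideanSpace ℝ (Fin q))).toSphere.prod
        (volume : Measure (EuclideanSpace ℝ (Fin p))).toSphere)

/-- The zonal spherical function `Z_σ^{[p,q]}(α)`: the matrix element of `T(g_α)` with respect to
the normalized `SO(p) × SO(q)`-invariant vector. -/
def zonalFunction (p q : ℕ) [NeZero p] [NeZero q] (σ : ℂ) (α : ℝ) : ℂ :=
  sectionInner (pseudoAction (hyperbolicRotation p q α) (zonalVector p q σ)) (zonalVector p q σ)

/-- `Λ(α; x, y) = 1 + (x² + y²) sinh² α - 2 x y sinh α cosh α`. -/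
def zonalKernel (α x y : ℝ) : ℝ :=
  1 + (x ^ 2 + y ^ 2) * Real.sinh α ^ 2 - 2 * x * y * Real.sinh α * Real.cosh α

/-- The Pochhammer symbol `(a)_n = a (a + 1) ⋯ (a + n - 1)`. -/
def pochhammerSymbol (a : ℂ) (n : ℕ) : ℂ := (ascPochhammer ℂ n).eval a

/-- The general term of the generalized hypergeometric (Horn) series in `r` variables. A pair
`(u, a)` in `num` (resp. `den`) contributes the factor `(a)_{u_1 n_1 + ⋯ + u_r n_r}` to the
numerator (resp. denominator). -/
def hornTerm {r : ℕ} (num den : List ((Fin r → ℕ) × ℂ)) (x : Fin r → ℂ) (n : Fin r → ℕ) : ℂ :=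
  (num.map fun a => pochhammerSymbol a.2 (∑ j, a.1 j * n j)).prod /
    (den.map fun b => pochhammerSymbol b.2 (∑ j, b.1 j * n j)).prod *
    ∏ i, x i ^ n i / (n i).factorial

/-- The sum of the Horn series. -/
def hornSeries {r : ℕ} (num den : List ((Fin r → ℕ) × ℂ)) (x : Fin r → ℂ) : ℂ :=
  ∑' n : Fin r → ℕ, hornTerm num den x n

/-- Numerator rows of the `₄F₂` series: `10 | -σ/2, 1-(σ+q)/2`, `01 | (σ+q)/2`, `11 | 1/2`. -/
def zonalNum (q : ℕ) (σ : ℂ) : List ((Fin 2 → ℕ) × ℂ) :=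
  [(![1, 0], -σ / 2), (![1, 0], 1 - (σ + q) / 2), (![0, 1], (σ + q) / 2), (![1, 1], 1 / 2)]

/-- Denominator rows of the `₄F₂` series: `11 | q/2`, `10 | p/2`. -/
def zonalDen (p q : ℕ) : List ((Fin 2 → ℕ) × ℂ) :=
  [(![1, 1], (q : ℂ) / 2), (![1, 0], (p : ℂ) / 2)]

/-- The point `(tanh² α, tanh² α)`. -/
def tanhSqPoint (α : ℝ) : Fin 2 → ℂ := fun _ => (Real.tanh α : ℂ) ^ 2

end

open MeasureTheory

noncomputable section

theorem pochhammerSymbol_zero (a : ℂ) : pochhammerSymbol a 0 = 1 := by simp [pochhammerSymbol]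

theorem pochhammerSymbol_succ (a : ℂ) (n : ℕ) :
    pochhammerSymbol a (n + 1) = pochhammerSymbol a n * (a + n) := by
  simp [pochhammerSymbol, ascPochhammer_succ_eval]

theorem pochhammerSymbol_add (a : ℂ) (m n : ℕ) :
    pochhammerSymbol a (m + n) = pochhammerSymbol a m * pochhammerSymbol (a + m) n := by
  induction n with
  | zero => simp [pochhammerSymbol_zero]
  | succ n ih =>
    rw [← add_assoc, pochhammerSymbol_succ, ih, pochhammerSymbol_succ]
    push_cast
    ring

theorem pochhammerSymbol_ne_zero {a : ℂ} (h : ∀ k : ℕ, a + k ≠ 0) (n : ℕ) :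
    pochhammerSymbol a n ≠ 0 := by
  induction n with
  | zero => simp [pochhammerSymbol_zero]
  | succ n ih => rw [pochhammerSymbol_succ]; exact mul_ne_zero ih (h n)

theorem pochhammerSymbol_div_factorial (a : ℂ) (n : ℕ) :
    pochhammerSymbol a n / (n.factorial : ℂ) = Ring.multichoose a n := by
  have h := Ring.factorial_nsmul_multichoose_eq_ascPochhammer a n
  rw [Polynomial.ascPochhammer_smeval_cast, Polynomial.ascPochhammer_smeval_eq_eval] at h
  have hn : (n.factorial : ℂ) ≠ 0 := by exact_mod_cast n.factorial_ne_zero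
  rw [pochhammerSymbol, ← h, nsmul_eq_mul, mul_div_cancel_left₀ _ hn]

/-- The Chu–Vandermonde identity. -/
theorem pochhammerSymbol_add_left (a b : ℂ) (n : ℕ) :
    pochhammerSymbol (a + b) n / (n.factorial : ℂ) =
      ∑ i ∈ Finset.range (n + 1), pochhammerSymbol a i / (i.factorial : ℂ) *
        (pochhammerSymbol b (n - i) / ((n - i).factorial : ℂ)) := by
  simp only [pochhammerSymbol_div_factorial]
  rw [← Finset.Nat.sum_antidiagonal_eq_sum_range_succ
    (fun i j => Ring.multichoose a i * Ring.multichoose b j)]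
  have h := Ring.add_choose_eq (r := -a) (s := -b) n (Commute.all _ _)
  rw [← neg_add, Ring.choose_neg'] at h
  rw [← smul_right_injective _ (Int.negOnePow n).isUnit.ne_zero |>.eq_iff]
  refine h.trans ?_
  rw [Finset.smul_sum]
  refine Finset.sum_congr rfl fun ij hij => ?_
  rw [Ring.choose_neg', Ring.choose_neg', ← Finset.HasAntidiagonal.mem_antidiagonal.1 hij, Nat.cast_add,
    Int.negOnePow_add, smul_mul_smul_comm]
  rfl

/-- The binomial series. -/
theorem hasSum_pochhammerSymbol (a : ℂ) {z : ℂ} (hz : ‖z‖ < 1) :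
    HasSum (fun n : ℕ => pochhammerSymbol a n / (n.factorial : ℂ) * z ^ n) ((1 - z) ^ (-a)) := by
  have h := (Complex.one_div_one_sub_cpow_hasFPowerSeriesOnBall_zero a).hasSum (y := z)
    (by simpa [enorm_eq_nnnorm, ← NNReal.coe_lt_coe] using hz)
  simp only [pochhammerSymbol_div_factorial, Ring.multichoose_eq]
  simpa [Complex.cpow_neg, mul_comm] using h

theorem hasSum_pochhammerSymbol_mul (a b : ℂ) (N : ℕ) {t : ℂ} (ht : ‖t‖ < 1) :
    HasSum (fun n : ℕ => pochhammerSymbol a n / (n.factorial : ℂ) *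
        (pochhammerSymbol (a + b + n) N / (N.factorial : ℂ)) * t ^ n)
      (∑ i ∈ Finset.range (N + 1), pochhammerSymbol b i / (i.factorial : ℂ) *
        (pochhammerSymbol a (N - i) / ((N - i).factorial : ℂ)) *
          (1 - t) ^ (-(a + (N - i : ℕ)))) := by
  have key := hasSum_sum fun i (_ : i ∈ Finset.range (N + 1)) =>
    (hasSum_pochhammerSymbol (a + (N - i : ℕ)) ht).mul_left
      (pochhammerSymbol b i / (i.factorial : ℂ) *
        (pochhammerSymbol a (N - i) / ((N - i).factorial : ℂ)))
  refine key.congr_fun ?_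
  intro n
  rw [show a + b + n = b + (a + n) by ring, pochhammerSymbol_add_left, Finset.mul_sum,
    Finset.sum_mul]
  refine Finset.sum_congr rfl fun i _ => ?_
  have h := pochhammerSymbol_add a n (N - i)
  rw [add_comm, pochhammerSymbol_add] at h
  linear_combination (-pochhammerSymbol b i / (i.factorial : ℂ) / ((N - i).factorial : ℂ) /
    (n.factorial : ℂ) * t ^ n) * h

theorem pochhammerSymbol_eq_prod (a : ℂ) (n : ℕ) :
    pochhammerSymbol a n = ∏ i ∈ Finset.range n, (a + i) := by
  induction n with
  | zero => simp [pochhammerSymbol_zero]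
  | succ n ih => rw [pochhammerSymbol_succ, ih, Finset.prod_range_succ]

theorem pochhammerSymbol_reflect (a : ℂ) (n : ℕ) :
    pochhammerSymbol (1 - a - n) n = (-1) ^ n * pochhammerSymbol a n := by
  rw [pochhammerSymbol_eq_prod, pochhammerSymbol_eq_prod, ← Finset.prod_range_reflect,
    show (-1 : ℂ) ^ n = ∏ _i ∈ Finset.range n, (-1 : ℂ) by simp, ← Finset.prod_mul_distrib]
  refine Finset.prod_congr rfl fun i hi => ?_
  have h := Finset.mem_range.1 hi
  rw [Nat.sub_sub, Nat.cast_sub (by omega)]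
  push_cast
  ring

theorem pochhammerSymbol_one (n : ℕ) : pochhammerSymbol 1 n = (n.factorial : ℂ) := by
  simp [pochhammerSymbol]

theorem pochhammerSymbol_one_sub_sub_mul (c : ℂ) {m s : ℕ} (h : m ≤ s) :
    pochhammerSymbol (1 - s - c) m * pochhammerSymbol c (s - m) =
      (-1) ^ m * pochhammerSymbol c s := by
  have h1 := pochhammerSymbol_reflect (c + (s - m : ℕ)) m
  have h2 := pochhammerSymbol_add c (s - m) m
  rw [Nat.sub_add_cancel h] at h2
  rw [h2, show (1 - s - c : ℂ) = 1 - (c + (s - m : ℕ)) - m by rw [Nat.cast_sub h]; ring, h1]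
  ring

theorem pochhammerSymbol_neg_natCast_mul {m s : ℕ} (h : m ≤ s) :
    pochhammerSymbol (-(s : ℂ)) m * ((s - m).factorial : ℂ) = (-1) ^ m * (s.factorial : ℂ) := by
  have h1 := pochhammerSymbol_one_sub_sub_mul 1 h
  rw [pochhammerSymbol_one, pochhammerSymbol_one] at h1
  rw [← h1]
  congr 2
  ring

theorem pochhammerSymbol_neg_natCast_eq_zero {m s : ℕ} (h : s < m) :
    pochhammerSymbol (-(s : ℂ)) m = 0 := by
  rw [pochhammerSymbol_eq_prod]
  exact Finset.prod_eq_zero (Finset.mem_range.2 h) (by simp)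

/-- The general term of the double series of the zonal function, at `σ = 2 s` and
`(tanh² α, tanh² α) = (t, t)`. -/
def zonalTerm (p q : ℕ) (s t : ℂ) (k : ℕ × ℕ) : ℂ :=
  pochhammerSymbol (-s) k.1 * pochhammerSymbol (1 - (s + q / 2)) k.1 *
    pochhammerSymbol (s + q / 2) k.2 * pochhammerSymbol (1 / 2) (k.1 + k.2) /
    (pochhammerSymbol (q / 2) (k.1 + k.2) * pochhammerSymbol (p / 2) k.1) *
    (t ^ (k.1 + k.2) / (k.1.factorial * k.2.factorial))

theorem hornTerm_zonal (p q : ℕ) (σ : ℂ) (α : ℝ) (n : Fin 2 → ℕ) :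
    hornTerm (zonalNum q σ) (zonalDen p q) (tanhSqPoint α) n =
      zonalTerm p q (σ / 2) ((Real.tanh α : ℂ) ^ 2) (n 0, n 1) := by
  simp only [hornTerm, zonalNum, zonalDen, tanhSqPoint, zonalTerm, List.map, List.prod_cons,
    List.prod_nil, Fin.sum_univ_two, Fin.prod_univ_two, Matrix.cons_val_zero, Matrix.cons_val_one,
    one_mul, zero_mul, add_zero, zero_add, mul_one, add_div, neg_div]
  rw [div_mul_div_comm, pow_add]
  ring

theorem half_natCast_add_ne_zero (q : ℕ) [NeZero q] (k : ℕ) : ((q : ℂ) / 2 + k) ≠ 0 := by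
  have h : (0 : ℝ) < (q : ℝ) / 2 + k := by
    have : (0 : ℝ) < q := by exact_mod_cast Nat.pos_of_ne_zero (NeZero.ne q)
    positivity
  have h2 : (((q : ℝ) / 2 + k : ℝ) : ℂ) ≠ 0 := by exact_mod_cast h.ne'
  simpa using h2

theorem pochhammerSymbol_half_ne_zero (q : ℕ) [NeZero q] (k : ℕ) :
    pochhammerSymbol ((q : ℂ) / 2) k ≠ 0 :=
  pochhammerSymbol_ne_zero (half_natCast_add_ne_zero q) k

theorem zonalTerm_natCast (p q : ℕ) [NeZero p] [NeZero q] {m s : ℕ} (h : m ≤ s) (t : ℂ) (n : ℕ) :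
    zonalTerm p q s t (m, n) = (s.factorial : ℂ) * pochhammerSymbol (1 / 2) m /
      ((m.factorial : ℂ) * pochhammerSymbol (q / 2) (s - m) * pochhammerSymbol (p / 2) m) * t ^ m *
      (pochhammerSymbol (m + 1 / 2) n / (n.factorial : ℂ) *
        (pochhammerSymbol (m + 1 / 2 + (q - 1) / 2 + n) (s - m) / ((s - m).factorial : ℂ)) *
          t ^ n) := by
  have h1 := pochhammerSymbol_neg_natCast_mul h
  have h2 := pochhammerSymbol_one_sub_sub_mul ((q : ℂ) / 2) h
  have h3 := pochhammerSymbol_add (1 / 2) m n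
  have h4 := pochhammerSymbol_add ((q : ℂ) / 2) s n
  have h5 := pochhammerSymbol_add ((q : ℂ) / 2) (m + n) (s - m)
  rw [show m + n + (s - m) = s + n by omega, h4] at h5
  rw [show (1 - s - (q : ℂ) / 2) = 1 - (s + q / 2) by ring] at h2
  rw [show ((m : ℂ) + 1 / 2 + (q - 1) / 2 + n) = q / 2 + (m + n : ℕ) by push_cast; ring,
    add_comm (m : ℂ) (1 / 2)]
  rw [show (q : ℂ) / 2 + s = s + q / 2 by ring] at h5
  have n1 := pochhammerSymbol_half_ne_zero q (m + n)
  have n2 := pochhammerSymbol_half_ne_zero q (s - m)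
  have n3 := pochhammerSymbol_half_ne_zero p m
  have n4 : ((s - m).factorial : ℂ) ≠ 0 := by exact_mod_cast Nat.factorial_ne_zero _
  have n5 : (m.factorial : ℂ) ≠ 0 := by exact_mod_cast Nat.factorial_ne_zero _
  have n6 : (n.factorial : ℂ) ≠ 0 := by exact_mod_cast Nat.factorial_ne_zero _
  have e : ((-1 : ℂ) ^ m) * (-1) ^ m = 1 := by rw [← mul_pow]; simp
  simp only [zonalTerm]
  rw [h3, pow_add]
  generalize pochhammerSymbol (1 - (s + (q : ℂ) / 2)) m = A at *
  generalize pochhammerSymbol (-(s : ℂ)) m = B at *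
  generalize pochhammerSymbol (s + (q : ℂ) / 2) n = X at *
  generalize pochhammerSymbol ((q : ℂ) / 2 + (m + n : ℕ)) (s - m) = Y at *
  generalize pochhammerSymbol ((q : ℂ) / 2) (m + n) = C at *
  generalize pochhammerSymbol ((q : ℂ) / 2) (s - m) = W at *
  generalize pochhammerSymbol ((q : ℂ) / 2) s = D at *
  generalize pochhammerSymbol ((p : ℂ) / 2) m = P at *
  generalize pochhammerSymbol (1 / 2) m = K at *
  generalize pochhammerSymbol (1 / 2 + (m : ℂ)) n = L at *
  field_simp
  generalize (-1 : ℂ) ^ m = ε at *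
  linear_combination K * L * t ^ m * t ^ n * (A * W * X * h1 + ε * s.factorial * X * h2 +
    s.factorial * D * X * e + s.factorial * h5)

/-- For `s` a natural number, the inner series of the zonal double series can be summed. -/
theorem hasSum_zonalTerm_natCast (p q : ℕ) [NeZero p] [NeZero q] {m s : ℕ} (h : m ≤ s) {t : ℂ}
    (ht : ‖t‖ < 1) :
    HasSum (fun n => zonalTerm p q s t (m, n)) ((s.factorial : ℂ) * pochhammerSymbol (1 / 2) m /
      ((m.factorial : ℂ) * pochhammerSymbol (q / 2) (s - m) * pochhammerSymbol (p / 2) m) * t ^ m *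
      ∑ i ∈ Finset.range (s - m + 1), pochhammerSymbol ((q - 1) / 2) i / (i.factorial : ℂ) *
        (pochhammerSymbol (m + 1 / 2) (s - m - i) / ((s - m - i).factorial : ℂ)) *
          (1 - t) ^ (-(m + 1 / 2 + (s - m - i : ℕ) : ℂ))) := by
  simp only [zonalTerm_natCast p q h]
  exact (hasSum_pochhammerSymbol_mul (m + 1 / 2) ((q - 1) / 2) (s - m) ht).mul_left _

/-- The binomial series converges absolutely. -/
theorem summable_norm_pochhammerSymbol (a : ℂ) {t : ℂ} (ht : ‖t‖ < 1) :
    Summable fun n : ℕ => ‖pochhammerSymbol a n / (n.factorial : ℂ) * t ^ n‖ :=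
  summable_norm_iff.2 (hasSum_pochhammerSymbol a ht).summable

theorem norm_pochhammerSymbol_half_div_le_one (q : ℕ) [NeZero q] (n : ℕ) :
    ‖pochhammerSymbol (1 / 2) n / pochhammerSymbol (q / 2) n‖ ≤ 1 := by
  induction n with
  | zero => simp [pochhammerSymbol_zero]
  | succ n ih =>
    rw [pochhammerSymbol_succ, pochhammerSymbol_succ, mul_div_mul_comm, norm_mul]
    refine mul_le_one₀ ih (norm_nonneg _) ?_
    have hq : (1 : ℝ) ≤ q := by exact_mod_cast Nat.pos_of_ne_zero (NeZero.ne q)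
    have h1 : (1 / 2 + (n : ℂ)) = ((1 / 2 + n : ℝ) : ℂ) := by push_cast; ring
    have h2 : ((q : ℂ) / 2 + n) = ((q / 2 + n : ℝ) : ℂ) := by push_cast; ring
    rw [h1, h2, ← Complex.ofReal_div, Complex.norm_real, Real.norm_of_nonneg (by positivity),
      div_le_one (by positivity)]
    linarith

theorem summable_norm_hypergeometric (a b c : ℂ) {t : ℂ} (ht : ‖t‖ < 1) :
    Summable fun n : ℕ => ‖pochhammerSymbol a n * pochhammerSymbol b n /
      (pochhammerSymbol c n * n.factorial) * t ^ n‖ := by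
  obtain ⟨r, hr, hr1⟩ := exists_between ht
  have lim : ∀ x y : ℂ, Filter.Tendsto (fun n : ℕ => (x + n) / (y + n)) Filter.atTop (nhds 1) := by
    intro x y
    simpa using tendsto_add_mul_div_add_mul_atTop_nhds x y (1 : ℂ) (one_ne_zero (α := ℂ))
  have h : Filter.Tendsto (fun n : ℕ => ‖(a + n) / (c + n) * ((b + n) / (1 + n)) * t‖)
      Filter.atTop (nhds ‖t‖) := by
    simpa using (((lim a c).mul (lim b 1)).mul_const t).norm
  refine summable_of_ratio_norm_eventually_le hr1 ?_
  filter_upwards [h.eventually (gt_mem_nhds hr)] with n hn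
  rw [norm_norm, norm_norm]
  refine le_trans (le_of_eq ?_) (mul_le_mul_of_nonneg_right hn.le (norm_nonneg _))
  rw [← norm_mul]
  congr 1
  simp only [pochhammerSymbol_succ, Nat.factorial_succ, Nat.cast_mul, Nat.cast_add, Nat.cast_one,
    pow_succ, div_eq_mul_inv, mul_inv]
  ring

theorem summable_norm_zonalTerm (p q : ℕ) [NeZero q] (s : ℂ) {t : ℂ} (ht : ‖t‖ < 1) :
    Summable fun k => ‖zonalTerm p q s t k‖ := by
  have h := (summable_norm_hypergeometric (-s) (1 - (s + q / 2)) (p / 2) ht).mul_norm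
    (summable_norm_pochhammerSymbol (s + q / 2) ht)
  refine h.of_nonneg_of_le (fun _ => norm_nonneg _) fun k => ?_
  refine le_trans (le_of_eq ?_) (mul_le_of_le_one_right (norm_nonneg _)
    (norm_pochhammerSymbol_half_div_le_one q (k.1 + k.2)))
  rw [← norm_mul]
  congr 1
  simp only [zonalTerm, pow_add, div_eq_mul_inv, mul_inv]
  ring

theorem hasSum_mul_prod {f g : ℕ → ℂ} {a b : ℂ} (hf : HasSum f a) (hg : HasSum g b) :
    HasSum (fun k : ℕ × ℕ => f k.1 * g k.2) (a * b) := by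
  have nf : Summable fun n => ‖f n‖ := hf.summable.norm
  have ng : Summable fun n => ‖g n‖ := hg.summable.norm
  exact hf.mul hg (summable_mul_of_summable_norm nf ng)

/-- A family of functions of `τ` in the unit disc, given by power series the coefficients of which
are polynomials in the parameter `s`. -/
def HasPolynomialSeries (f : ℂ → ℂ → ℂ) : Prop :=
  ∃ a : ℕ → Polynomial ℂ, ∀ s τ : ℂ, ‖τ‖ < 1 →
    HasSum (fun n => (a n).eval s * τ ^ n) (f s τ)

theorem HasPolynomialSeries.of_hasSum {ι : Type*} {f : ℂ → ℂ → ℂ} (d : ι → ℕ)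
    (hd : ∀ n, (d ⁻¹' {n}).Finite) (c : ι → Polynomial ℂ)
    (h : ∀ s τ : ℂ, ‖τ‖ < 1 → HasSum (fun i => (c i).eval s * τ ^ d i) (f s τ)) :
    HasPolynomialSeries f := by
  refine ⟨fun n => ∑ i ∈ (hd n).toFinset, c i, fun s τ hτ => ?_⟩
  refine ((Equiv.sigmaFiberEquiv d).hasSum_iff.2 (h s τ hτ)).sigma fun n => ?_
  have : Fintype {i // d i = n} := (hd n).fintype
  have h1 := hasSum_fintype fun i : {i // d i = n} => (c i).eval s * τ ^ d i
  rw [← Finset.sum_subtype (hd n).toFinset (by simp) fun i => (c i).eval s * τ ^ d i] at h1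
  rw [Polynomial.eval_finsetSum, Finset.sum_mul, Finset.sum_congr rfl fun i hi => ?_]
  · exact h1
  · rw [show d i = n by simpa using hi]

theorem HasPolynomialSeries.mul {f g : ℂ → ℂ → ℂ} (hf : HasPolynomialSeries f)
    (hg : HasPolynomialSeries g) : HasPolynomialSeries fun s τ => f s τ * g s τ := by
  obtain ⟨a, ha⟩ := hf
  obtain ⟨b, hb⟩ := hg
  refine .of_hasSum (fun k : ℕ × ℕ => k.1 + k.2) (fun n => ?_) (fun k => a k.1 * b k.2)
    fun s τ hτ => ?_
  · refine (Finset.HasAntidiagonal.antidiagonal n).finite_toSet.subset fun k hk => ?_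
    simpa using hk
  · refine (hasSum_mul_prod (ha s τ hτ) (hb s τ hτ)).congr_fun fun k => ?_
    simp only [Polynomial.eval_mul, pow_add]
    ring

theorem eq_of_hasSum_pow_eq {a b : ℕ → ℂ} {f : ℂ → ℂ}
    (ha : ∀ τ : ℂ, ‖τ‖ < 1 → HasSum (fun n => a n * τ ^ n) (f τ))
    (hb : ∀ τ : ℂ, ‖τ‖ < 1 → HasSum (fun n => b n * τ ^ n) (f τ)) : a = b := by
  have key : ∀ {a : ℕ → ℂ}, (∀ τ : ℂ, ‖τ‖ < 1 → HasSum (fun n => a n * τ ^ n) (f τ)) →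
      HasFPowerSeriesAt f (FormalMultilinearSeries.ofScalars ℂ a) 0 := by
    intro a ha
    refine HasFPowerSeriesOnBall.hasFPowerSeriesAt (r := 1) ⟨?_, one_pos, ?_⟩
    · refine ENNReal.le_of_forall_nnreal_lt fun r hr => ?_
      refine FormalMultilinearSeries.le_radius_of_summable_norm _ ?_
      have hr' : ‖((r : ℝ) : ℂ)‖ < 1 := by simpa using hr
      simpa [FormalMultilinearSeries.ofScalars_norm] using
        summable_norm_iff.2 (ha _ hr').summable
    · intro y hy
      simpa [mul_comm] using ha y (by simpa [enorm_eq_nnnorm, ← NNReal.coe_lt_coe] using hy)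
  have h := (key ha).eq_formalMultilinearSeries (key hb)
  exact FormalMultilinearSeries.ofScalars_series_injective ℂ ℂ h

theorem HasPolynomialSeries.eq_of_natCast {f g : ℂ → ℂ → ℂ} (hf : HasPolynomialSeries f)
    (hg : HasPolynomialSeries g) (h : ∀ (s : ℕ) (τ : ℂ), ‖τ‖ < 1 → f s τ = g s τ) (s : ℂ) {τ : ℂ}
    (hτ : ‖τ‖ < 1) : f s τ = g s τ := by
  obtain ⟨a, ha⟩ := hf
  obtain ⟨b, hb⟩ := hg
  have hab : a = b := by
    funext n
    refine Polynomial.eq_of_infinite_eval_eq _ _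
      ((Set.infinite_range_of_injective (Nat.cast_injective (R := ℂ))).mono ?_)
    rintro _ ⟨k, rfl⟩
    exact congrFun (eq_of_hasSum_pow_eq (ha k) fun τ hτ => h k τ hτ ▸ hb k τ hτ) n
  exact (ha s τ hτ).unique (hab ▸ hb s τ hτ)

/-- A probability measure on `[-1, 1]` with the moments of the law of a coordinate of a uniformly
distributed point of the unit sphere of `ℝ^p`. -/
structure IsSphereCoordinateLaw (p : ℕ) (ν : Measure ℝ) : Prop where
  isProbabilityMeasure : IsProbabilityMeasure ν
  ae_mem : ∀ᵐ x ∂ν, x ∈ Set.Icc (-1 : ℝ) 1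
  integral_odd : ∀ k : ℕ, ∫ x, x ^ (2 * k + 1) ∂ν = 0
  integral_even : ∀ k : ℕ,
    (2 * k + p) * ∫ x, x ^ (2 * (k + 1)) ∂ν = (2 * k + 1) * ∫ x, x ^ (2 * k) ∂ν

namespace IsSphereCoordinateLaw

variable {p q : ℕ} {ν ν' : Measure ℝ}

theorem integrable (h : IsSphereCoordinateLaw p ν) {E : Type*} [NormedAddCommGroup E]
    [SecondCountableTopology E] {f : ℝ → E} (hf : Continuous f) : Integrable f ν := by
  have := h.isProbabilityMeasure
  obtain ⟨C, hC⟩ := isCompact_Icc.exists_bound_of_continuousOn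
    (hf.continuousOn (s := Set.Icc (-1 : ℝ) 1))
  exact Integrable.of_bound hf.aestronglyMeasurable C (h.ae_mem.mono fun x hx => hC x hx)

theorem integral_pow_eq [NeZero p] (h : IsSphereCoordinateLaw p ν)
    (h' : IsSphereCoordinateLaw p ν') (n : ℕ) : ∫ x, x ^ n ∂ν = ∫ x, x ^ n ∂ν' := by
  have := h.isProbabilityMeasure
  have := h'.isProbabilityMeasure
  obtain ⟨k, rfl | rfl⟩ := n.even_or_odd'
  · induction k with
    | zero => simp
    | succ k ih =>
      have hp : (0 : ℝ) < 2 * k + p := by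
        have : (0 : ℝ) < p := by exact_mod_cast Nat.pos_of_ne_zero (NeZero.ne p)
        positivity
      refine mul_left_cancel₀ hp.ne' ?_
      rw [h.integral_even, h'.integral_even, ih]
  · rw [h.integral_odd, h'.integral_odd]

theorem integral_polynomial_eq [NeZero p] (h : IsSphereCoordinateLaw p ν)
    (h' : IsSphereCoordinateLaw p ν') (P : Polynomial ℝ) :
    ∫ x, P.eval x ∂ν = ∫ x, P.eval x ∂ν' := by
  simp only [Polynomial.eval_eq_sum_range]
  rw [integral_finsetSum _ fun i _ => h.integrable (by fun_prop),
    integral_finsetSum _ fun i _ => h'.integrable (by fun_prop)]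
  simp only [integral_const_mul, h.integral_pow_eq h']

/-- By the Weierstrass approximation theorem, the moments determine the measure. -/
theorem eq [NeZero p] (h : IsSphereCoordinateLaw p ν) (h' : IsSphereCoordinateLaw p ν') :
    ν = ν' := by
  have := h.isProbabilityMeasure
  have := h'.isProbabilityMeasure
  refine ext_of_forall_integral_eq_of_IsFiniteMeasure fun f => ?_
  refine eq_of_forall_dist_le fun ε hε => ?_
  obtain ⟨P, hP⟩ := exists_polynomial_near_of_continuousOn (-1) 1 f f.continuous.continuousOn
    (ε / 2) (by positivity)
  have key : ∀ {μ : Measure ℝ}, IsSphereCoordinateLaw p μ →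
      dist (∫ x, P.eval x ∂μ) (∫ x, f x ∂μ) ≤ ε / 2 := by
    intro μ hμ
    have := hμ.isProbabilityMeasure
    rw [dist_eq_norm, ← integral_sub (hμ.integrable P.continuous) (hμ.integrable f.continuous)]
    have hb : ∀ᵐ x ∂μ, ‖P.eval x - f x‖ ≤ ε / 2 := hμ.ae_mem.mono fun x hx => (hP x hx).le
    simpa using norm_integral_le_of_norm_le_const hb
  have h1 := key h
  have h2 := key h'
  rw [h.integral_polynomial_eq h'] at h1
  linarith [dist_triangle_left (∫ x, f x ∂ν) (∫ x, f x ∂ν') (∫ x, P.eval x ∂ν')]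

theorem integral_ofReal_pow_odd (h : IsSphereCoordinateLaw p ν) (k : ℕ) :
    ∫ x, (x : ℂ) ^ (2 * k + 1) ∂ν = 0 := by
  have h1 := h.integral_odd k
  simp only [← Complex.ofReal_pow]
  rw [integral_complex_ofReal, h1, Complex.ofReal_zero]

theorem integral_ofReal_pow_even [NeZero p] (h : IsSphereCoordinateLaw p ν) (k : ℕ) :
    ∫ x, (x : ℂ) ^ (2 * k) ∂ν = pochhammerSymbol (1 / 2) k / pochhammerSymbol (p / 2) k := by
  have := h.isProbabilityMeasure
  induction k with
  | zero => simp [pochhammerSymbol_zero]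
  | succ k ih =>
    have h1 := congrArg Complex.ofReal (h.integral_even k)
    push_cast [← integral_complex_ofReal] at h1
    rw [ih] at h1
    have n1 := half_natCast_add_ne_zero p k
    have n2 := pochhammerSymbol_half_ne_zero p k
    rw [pochhammerSymbol_succ, pochhammerSymbol_succ]
    generalize pochhammerSymbol (1 / 2) k = A at *
    generalize pochhammerSymbol ((p : ℂ) / 2) k = B at *
    rw [eq_div_iff (mul_ne_zero n2 n1)]
    field_simp at h1 ⊢
    linear_combination h1

theorem integral_one_sub_sq_pow_mul [NeZero p] (h : IsSphereCoordinateLaw p ν) (i k : ℕ) :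
    ∫ x, (1 - (x : ℂ) ^ 2) ^ i * (x : ℂ) ^ (2 * k) ∂ν =
      pochhammerSymbol ((p - 1) / 2) i * pochhammerSymbol (1 / 2) k /
        pochhammerSymbol (p / 2) (i + k) := by
  induction i generalizing k with
  | zero => simp [pochhammerSymbol_zero, h.integral_ofReal_pow_even]
  | succ i ih =>
    have e : (fun x : ℝ => (1 - (x : ℂ) ^ 2) ^ (i + 1) * (x : ℂ) ^ (2 * k)) = fun x : ℝ =>
        (1 - (x : ℂ) ^ 2) ^ i * (x : ℂ) ^ (2 * k) -
          (1 - (x : ℂ) ^ 2) ^ i * (x : ℂ) ^ (2 * (k + 1)) := by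
      funext x
      ring
    rw [e, integral_sub (h.integrable (by fun_prop)) (h.integrable (by fun_prop)), ih, ih,
      ← add_assoc, add_right_comm i 1 k, pochhammerSymbol_succ, pochhammerSymbol_succ,
      pochhammerSymbol_succ]
    have n1 := half_natCast_add_ne_zero p (i + k)
    have n2 := pochhammerSymbol_half_ne_zero p (i + k)
    generalize pochhammerSymbol (1 / 2) k = A at *
    generalize pochhammerSymbol ((p : ℂ) / 2) (i + k) = B at *
    have hD : ((p : ℂ) - 1) / 2 + i = (p / 2 + (i + k : ℕ)) - (1 / 2 + k) := by push_cast; ring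
    rw [hD]
    generalize (p : ℂ) / 2 + (i + k : ℕ) = D at *
    generalize pochhammerSymbol (((p : ℂ) - 1) / 2) i = E at *
    field_simp

end IsSphereCoordinateLaw

/-- The roots `xy ± √((1 - x²)(1 - y²))` of `z² - 2xyz + x² + y² - 1`, for `ε = 1` and `ε = -1`. -/
def kernelRoot (ε : ℝ) (w : ℝ × ℝ) : ℝ := Real.cos (Real.arccos w.1 + ε * Real.arccos w.2)

theorem continuous_kernelRoot (ε : ℝ) : Continuous (kernelRoot ε) := by
  unfold kernelRoot
  fun_prop

theorem abs_kernelRoot_le (ε : ℝ) (w : ℝ × ℝ) : |kernelRoot ε w| ≤ 1 := Real.abs_cos_le_one _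

theorem kernelRoot_add {x y : ℝ} (hx : x ∈ Set.Icc (-1 : ℝ) 1) (hy : y ∈ Set.Icc (-1 : ℝ) 1) :
    kernelRoot 1 (x, y) + kernelRoot (-1) (x, y) = 2 * (x * y) := by
  have h1 := Real.cos_arccos hx.1 hx.2
  have h2 := Real.cos_arccos hy.1 hy.2
  simp only [kernelRoot, one_mul, neg_one_mul, ← sub_eq_add_neg, Real.cos_add, Real.cos_sub, h1, h2]
  ring

theorem kernelRoot_mul {x y : ℝ} (hx : x ∈ Set.Icc (-1 : ℝ) 1) (hy : y ∈ Set.Icc (-1 : ℝ) 1) :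
    kernelRoot 1 (x, y) * kernelRoot (-1) (x, y) = x ^ 2 + y ^ 2 - 1 := by
  have h1 := Real.cos_arccos hx.1 hx.2
  have h2 := Real.cos_arccos hy.1 hy.2
  have h3 := Real.sin_sq_add_cos_sq (Real.arccos x)
  have h4 := Real.sin_sq_add_cos_sq (Real.arccos y)
  rw [h1] at h3
  rw [h2] at h4
  simp only [kernelRoot, one_mul, neg_one_mul, ← sub_eq_add_neg, Real.cos_add, Real.cos_sub, h1, h2]
  linear_combination (-Real.sin (Real.arccos y) ^ 2) * h3 + (x ^ 2 - 1) * h4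

theorem norm_mul_kernelRoot_lt_one {τ : ℂ} (hτ : ‖τ‖ < 1) (ε : ℝ) (w : ℝ × ℝ) :
    ‖τ * kernelRoot ε w‖ < 1 := by
  rw [norm_mul, Complex.norm_real]
  exact (mul_le_of_le_one_right (norm_nonneg _) (abs_kernelRoot_le ε w)).trans_lt hτ

/-- `(1 - 2xyτ + (x² + y² - 1)τ²)^s`, in factorized form. -/
def kernelPow (s τ : ℂ) (w : ℝ × ℝ) : ℂ :=
  (1 - τ * kernelRoot 1 w) ^ s * (1 - τ * kernelRoot (-1) w) ^ s

/-- The general term of the expansion of `kernelPow`. -/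
def kernelPowTerm (s τ : ℂ) (k : ℕ × ℕ) (w : ℝ × ℝ) : ℂ :=
  pochhammerSymbol (-s) k.1 / (k.1.factorial : ℂ) * (τ * kernelRoot 1 w) ^ k.1 *
    (pochhammerSymbol (-s) k.2 / (k.2.factorial : ℂ) * (τ * kernelRoot (-1) w) ^ k.2)

theorem hasSum_kernelPowTerm (s : ℂ) {τ : ℂ} (hτ : ‖τ‖ < 1) (w : ℝ × ℝ) :
    HasSum (fun k => kernelPowTerm s τ k w) (kernelPow s τ w) := by
  have h1 := hasSum_pochhammerSymbol (-s) (norm_mul_kernelRoot_lt_one hτ 1 w)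
  have h2 := hasSum_pochhammerSymbol (-s) (norm_mul_kernelRoot_lt_one hτ (-1) w)
  rw [neg_neg] at h1 h2
  have h := hasSum_mul_prod h1 h2
  simp only [kernelPowTerm, kernelPow]
  convert h

theorem norm_kernelPowTerm_le (s τ : ℂ) (k : ℕ × ℕ) (w : ℝ × ℝ) :
    ‖kernelPowTerm s τ k w‖ ≤ ‖pochhammerSymbol (-s) k.1 / (k.1.factorial : ℂ) * τ ^ k.1‖ *
      ‖pochhammerSymbol (-s) k.2 / (k.2.factorial : ℂ) * τ ^ k.2‖ := by
  have key : ∀ (ε : ℝ) (n : ℕ), ‖pochhammerSymbol (-s) n / (n.factorial : ℂ) *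
      (τ * kernelRoot ε w) ^ n‖ ≤ ‖pochhammerSymbol (-s) n / (n.factorial : ℂ) * τ ^ n‖ := by
    intro ε n
    rw [mul_pow, ← mul_assoc, norm_mul _ ((kernelRoot ε w : ℂ) ^ n), norm_pow, Complex.norm_real]
    exact mul_le_of_le_one_right (norm_nonneg _)
      (pow_le_one₀ (norm_nonneg _) (abs_kernelRoot_le ε w))
  rw [kernelPowTerm, norm_mul]
  exact mul_le_mul (key _ _) (key _ _) (norm_nonneg _) (norm_nonneg _)

theorem continuous_kernelPowTerm (s τ : ℂ) (k : ℕ × ℕ) : Continuous (kernelPowTerm s τ k) := by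
  have h1 := Complex.continuous_ofReal.comp (continuous_kernelRoot 1)
  have h2 := Complex.continuous_ofReal.comp (continuous_kernelRoot (-1))
  exact ((continuous_const.mul ((continuous_const.mul h1).pow _))).mul
    (continuous_const.mul ((continuous_const.mul h2).pow _))

theorem hasSum_integral_kernelPowTerm (μ : Measure (ℝ × ℝ)) [IsProbabilityMeasure μ] (s : ℂ)
    {τ : ℂ} (hτ : ‖τ‖ < 1) :
    HasSum (fun k => ∫ w, kernelPowTerm s τ k w ∂μ) (∫ w, kernelPow s τ w ∂μ) := by
  have hi : ∀ k, Integrable (kernelPowTerm s τ k) μ := fun k =>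
    Integrable.of_bound (continuous_kernelPowTerm s τ k).aestronglyMeasurable _
      (Filter.Eventually.of_forall (norm_kernelPowTerm_le s τ k))
  have hs : Summable fun k => ∫ w, ‖kernelPowTerm s τ k w‖ ∂μ := by
    refine ((summable_norm_pochhammerSymbol (-s) hτ).mul_of_nonneg
      (summable_norm_pochhammerSymbol (-s) hτ) (fun _ => norm_nonneg _)
      fun _ => norm_nonneg _).of_nonneg_of_le (fun k => integral_nonneg fun _ => norm_nonneg _)
      fun k => ?_
    simpa using integral_mono (hi k).norm (integrable_const (μ := μ) _)
      (norm_kernelPowTerm_le s τ k)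
  have h := hasSum_integral_of_summable_integral_norm hi hs
  simpa only [(hasSum_kernelPowTerm s hτ _).tsum_eq] using h

theorem finite_preimage_add (n : ℕ) : ((fun k : ℕ × ℕ => k.1 + k.2) ⁻¹' {n}).Finite :=
  (Finset.HasAntidiagonal.antidiagonal n).finite_toSet.subset fun k hk => by simpa using hk

theorem hasPolynomialSeries_integral_kernelPow (μ : Measure (ℝ × ℝ)) [IsProbabilityMeasure μ] :
    HasPolynomialSeries fun s τ => ∫ w, kernelPow s τ w ∂μ := by
  refine .of_hasSum (fun k : ℕ × ℕ => k.1 + k.2) finite_preimage_add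
    (fun k => Polynomial.C ((∫ w, (kernelRoot 1 w : ℂ) ^ k.1 * (kernelRoot (-1) w : ℂ) ^ k.2 ∂μ) /
      (k.1.factorial * k.2.factorial)) * (ascPochhammer ℂ k.1).comp (-Polynomial.X) *
      (ascPochhammer ℂ k.2).comp (-Polynomial.X)) fun s τ hτ => ?_
  refine (hasSum_integral_kernelPowTerm μ s hτ).congr_fun fun k => ?_
  have e : kernelPowTerm s τ k = fun w => (pochhammerSymbol (-s) k.1 / (k.1.factorial : ℂ) *
      (pochhammerSymbol (-s) k.2 / (k.2.factorial : ℂ)) * τ ^ (k.1 + k.2)) *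
      ((kernelRoot 1 w : ℂ) ^ k.1 * (kernelRoot (-1) w : ℂ) ^ k.2) := by
    funext w
    simp only [kernelPowTerm, mul_pow, pow_add]
    ring
  rw [e, integral_const_mul]
  simp only [Polynomial.eval_mul, Polynomial.eval_C, Polynomial.eval_comp, Polynomial.eval_neg,
    Polynomial.eval_X, pochhammerSymbol, div_eq_mul_inv, mul_inv]
  ring

theorem hasPolynomialSeries_one_sub_sq_cpow :
    HasPolynomialSeries fun s τ => (1 - τ ^ 2) ^ (-(s + 1 / 2)) := by
  refine .of_hasSum (fun n : ℕ => 2 * n) (fun n => ?_)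
    (fun n => Polynomial.C (n.factorial : ℂ)⁻¹ *
      (ascPochhammer ℂ n).comp (Polynomial.X + Polynomial.C (1 / 2))) fun s τ hτ => ?_
  · exact (Set.finite_singleton n).preimage (mul_right_injective₀ two_ne_zero).injOn
  · have h : ‖τ ^ 2‖ < 1 := by
      rw [norm_pow]
      exact pow_lt_one₀ (norm_nonneg _) hτ two_ne_zero
    refine (hasSum_pochhammerSymbol (s + 1 / 2) h).congr_fun fun n => ?_
    simp only [Polynomial.eval_mul, Polynomial.eval_C, Polynomial.eval_comp, Polynomial.eval_add,
      Polynomial.eval_X, pochhammerSymbol, div_eq_mul_inv, pow_mul]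
    ring

theorem hasPolynomialSeries_tsum_zonalTerm (p q : ℕ) [NeZero q] :
    HasPolynomialSeries fun s τ => ∑' k, zonalTerm p q s (τ ^ 2) k := by
  refine .of_hasSum (fun k : ℕ × ℕ => 2 * (k.1 + k.2)) (fun n => ?_)
    (fun k => Polynomial.C (pochhammerSymbol (1 / 2) (k.1 + k.2) /
      (pochhammerSymbol (q / 2) (k.1 + k.2) * pochhammerSymbol (p / 2) k.1) /
        (k.1.factorial * k.2.factorial)) *
      ((ascPochhammer ℂ k.1).comp (-Polynomial.X) *
        (ascPochhammer ℂ k.1).comp (1 - (Polynomial.X + Polynomial.C ((q : ℂ) / 2))) *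
        (ascPochhammer ℂ k.2).comp (Polynomial.X + Polynomial.C ((q : ℂ) / 2))))
    fun s τ hτ => ?_
  · exact ((finite_preimage_add (n / 2)).subset fun k hk => by
      simp only [Set.mem_preimage, Set.mem_singleton_iff] at hk ⊢; omega)
  · have h : ‖τ ^ 2‖ < 1 := by
      rw [norm_pow]
      exact pow_lt_one₀ (norm_nonneg _) hτ two_ne_zero
    refine (summable_norm_zonalTerm p q s h).of_norm.hasSum.congr_fun fun k => ?_
    simp only [Polynomial.eval_mul, Polynomial.eval_C, Polynomial.eval_comp, Polynomial.eval_add,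
      Polynomial.eval_sub, Polynomial.eval_one, Polynomial.eval_neg,
      Polynomial.eval_X, zonalTerm, pochhammerSymbol, div_eq_mul_inv, pow_mul, mul_inv]
    ring

theorem kernelPow_natCast (s : ℕ) (τ : ℂ) {w : ℝ × ℝ} (hx : w.1 ∈ Set.Icc (-1 : ℝ) 1)
    (hy : w.2 ∈ Set.Icc (-1 : ℝ) 1) :
    kernelPow s τ w =
      ((1 - τ ^ 2) * (1 - (w.2 : ℂ) ^ 2) + ((w.2 : ℂ) - τ * w.1) ^ 2) ^ s := by
  have h1 := congrArg Complex.ofReal (kernelRoot_add hx hy)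
  have h2 := congrArg Complex.ofReal (kernelRoot_mul hx hy)
  push_cast at h1 h2
  rw [kernelPow, Complex.cpow_natCast, Complex.cpow_natCast, ← mul_pow]
  congr 1
  linear_combination (-τ) * h1 + τ ^ 2 * h2

theorem sum_range_two_mul_add_one {f : ℕ → ℂ} (hf : ∀ k, f (2 * k + 1) = 0) (n : ℕ) :
    ∑ l ∈ Finset.range (2 * n + 1), f l = ∑ k ∈ Finset.range (n + 1), f (2 * k) := by
  induction n with
  | zero => simp
  | succ n ih =>
    rw [Finset.sum_range_succ _ (n + 1), ← ih, show 2 * (n + 1) + 1 = 2 * n + 1 + 1 + 1 by ring,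
      Finset.sum_range_succ, Finset.sum_range_succ, hf, add_zero, mul_add, mul_one]

/-- The choice of an even subset in terms of Pochhammer symbols. -/
theorem choose_two_mul_two_mul {m M : ℕ} (h : m ≤ M) :
    (Nat.choose (2 * M) (2 * m) : ℂ) * pochhammerSymbol (1 / 2) (M - m) =
      (M.factorial : ℂ) * pochhammerSymbol (m + 1 / 2) (M - m) /
        (m.factorial * (M - m).factorial) := by
  have key : ∀ n : ℕ, ((2 * n).factorial : ℂ) =
      4 ^ n * n.factorial * pochhammerSymbol (1 / 2) n := by
    intro n
    induction n with
    | zero => simp [pochhammerSymbol_zero]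
    | succ n ih =>
      rw [show 2 * (n + 1) = 2 * n + 1 + 1 by ring, Nat.factorial_succ, Nat.factorial_succ,
        pochhammerSymbol_succ, Nat.factorial_succ]
      push_cast
      rw [ih]
      ring
  obtain ⟨j, rfl⟩ := Nat.exists_eq_add_of_le h
  have hn : ∀ n : ℕ, (n.factorial : ℂ) ≠ 0 := fun n => by exact_mod_cast n.factorial_ne_zero
  have hp : ∀ n : ℕ, pochhammerSymbol (1 / 2) n ≠ 0 := fun n => by
    simpa using pochhammerSymbol_half_ne_zero 1 n
  rw [Nat.cast_choose ℂ (by omega), show 2 * (m + j) - 2 * m = 2 * j by omega, key, key, key,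
    Nat.add_sub_cancel_left, pochhammerSymbol_add, add_comm (m : ℂ)]
  have := hn m
  have := hn j
  have := hp m
  have := hp j
  generalize pochhammerSymbol (1 / 2) m = A at *
  generalize pochhammerSymbol (1 / 2) j = B at *
  generalize pochhammerSymbol (1 / 2 + m) j = C at *
  field_simp
  ring

section Law

variable {p q : ℕ} {ν ν' : Measure ℝ}

theorem IsSphereCoordinateLaw.ae_mem_prod (h : IsSphereCoordinateLaw p ν)
    (h' : IsSphereCoordinateLaw q ν') :
    ∀ᵐ w ∂ν.prod ν', w.1 ∈ Set.Icc (-1 : ℝ) 1 ∧ w.2 ∈ Set.Icc (-1 : ℝ) 1 := by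
  have := h.isProbabilityMeasure
  have := h'.isProbabilityMeasure
  exact (Measure.quasiMeasurePreserving_fst.ae h.ae_mem).and
    (Measure.quasiMeasurePreserving_snd.ae h'.ae_mem)

theorem IsSphereCoordinateLaw.integrable_prod (h : IsSphereCoordinateLaw p ν)
    (h' : IsSphereCoordinateLaw q ν') {f : ℝ × ℝ → ℂ} (hf : Continuous f) :
    Integrable f (ν.prod ν') := by
  have := h.isProbabilityMeasure
  have := h'.isProbabilityMeasure
  obtain ⟨C, hC⟩ := (isCompact_Icc.prod isCompact_Icc).exists_bound_of_continuousOn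
    (hf.continuousOn (s := Set.Icc (-1 : ℝ) 1 ×ˢ Set.Icc (-1 : ℝ) 1))
  exact Integrable.of_bound hf.aestronglyMeasurable C
    ((h.ae_mem_prod h').mono fun w hw => hC w hw)

theorem integral_kernelPow_natCast [NeZero p] [NeZero q] (h : IsSphereCoordinateLaw p ν)
    (h' : IsSphereCoordinateLaw q ν') (s : ℕ) (τ : ℂ) :
    ∫ w, kernelPow s τ w ∂ν.prod ν' =
      ∑ m ∈ Finset.range (s + 1), ∑ i ∈ Finset.range (s - m + 1),
        (s.factorial : ℂ) * pochhammerSymbol (1 / 2) m /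
          ((m.factorial : ℂ) * pochhammerSymbol (q / 2) (s - m) * pochhammerSymbol (p / 2) m) *
          (τ ^ 2) ^ m * (pochhammerSymbol ((q - 1) / 2) i / (i.factorial : ℂ) *
            (pochhammerSymbol (m + 1 / 2) (s - m - i) / ((s - m - i).factorial : ℂ)) *
            (1 - τ ^ 2) ^ i) := by
  have := h.isProbabilityMeasure
  have := h'.isProbabilityMeasure
  have e1 : ∫ w, kernelPow s τ w ∂ν.prod ν' = ∫ w, ∑ i ∈ Finset.range (s + 1),
      ∑ l ∈ Finset.range (2 * (s - i) + 1), ((1 - τ ^ 2) ^ i * (-τ) ^ l * (s.choose i : ℂ) *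
        ((2 * (s - i)).choose l : ℂ)) * ((w.1 : ℂ) ^ l *
          ((1 - (w.2 : ℂ) ^ 2) ^ i * (w.2 : ℂ) ^ (2 * (s - i) - l))) ∂ν.prod ν' := by
    refine integral_congr_ae ((h.ae_mem_prod h').mono fun w hw => ?_)
    simp only
    rw [kernelPow_natCast s τ hw.1 hw.2, add_pow]
    refine Finset.sum_congr rfl fun i _ => ?_
    rw [← pow_mul, show (w.2 : ℂ) - τ * w.1 = -τ * w.1 + w.2 by ring, add_pow, Finset.mul_sum,
      Finset.sum_mul]
    refine Finset.sum_congr rfl fun l _ => ?_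
    rw [mul_pow, mul_pow]
    ring
  rw [e1, integral_finsetSum _ fun i _ => h.integrable_prod h' (by fun_prop)]
  have e2 : ∀ i ∈ Finset.range (s + 1), ∫ w, ∑ l ∈ Finset.range (2 * (s - i) + 1),
      ((1 - τ ^ 2) ^ i * (-τ) ^ l * (s.choose i : ℂ) *
        ((2 * (s - i)).choose l : ℂ)) * ((w.1 : ℂ) ^ l *
          ((1 - (w.2 : ℂ) ^ 2) ^ i * (w.2 : ℂ) ^ (2 * (s - i) - l))) ∂ν.prod ν' =
      ∑ m ∈ Finset.range (s - i + 1),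
        (s.factorial : ℂ) * pochhammerSymbol (1 / 2) m /
          ((m.factorial : ℂ) * pochhammerSymbol (q / 2) (s - m) * pochhammerSymbol (p / 2) m) *
          (τ ^ 2) ^ m * (pochhammerSymbol ((q - 1) / 2) i / (i.factorial : ℂ) *
            (pochhammerSymbol (m + 1 / 2) (s - m - i) / ((s - m - i).factorial : ℂ)) *
            (1 - τ ^ 2) ^ i) := by
    intro i hi
    rw [integral_finsetSum _ fun i _ => h.integrable_prod h' (by fun_prop)]
    simp only [integral_const_mul]
    rw [sum_range_two_mul_add_one]
    · refine Finset.sum_congr rfl fun m hm => ?_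
      rw [Finset.mem_range] at hi hm
      rw [integral_prod_mul (fun x : ℝ => (x : ℂ) ^ (2 * m))
        (fun y : ℝ => (1 - (y : ℂ) ^ 2) ^ i * (y : ℂ) ^ (2 * (s - i) - 2 * m)),
        h.integral_ofReal_pow_even, ← Nat.mul_sub, h'.integral_one_sub_sq_pow_mul]
      have hc := choose_two_mul_two_mul (show m ≤ s - i by omega)
      rw [show i + (s - i - m) = s - m by omega, Nat.cast_choose ℂ (show i ≤ s by omega),
        pow_mul, neg_sq]
      rw [show s - m - i = s - i - m by omega]
      have n1 := pochhammerSymbol_half_ne_zero q (s - m)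
      have n2 := pochhammerSymbol_half_ne_zero p m
      have hn : ∀ n : ℕ, (n.factorial : ℂ) ≠ 0 := fun n => by exact_mod_cast n.factorial_ne_zero
      have n3 := hn (s - i)
      have n4 := hn i
      have n5 := hn m
      have n6 := hn (s - i - m)
      generalize pochhammerSymbol ((q : ℂ) / 2) (s - m) = A at *
      generalize pochhammerSymbol ((p : ℂ) / 2) m = B at *
      generalize pochhammerSymbol (((q : ℂ) - 1) / 2) i = C at *
      generalize pochhammerSymbol ((m : ℂ) + 1 / 2) (s - i - m) = D at *
      generalize pochhammerSymbol (1 / 2) (s - i - m) = E at *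
      generalize pochhammerSymbol (1 / 2) m = F at *
      generalize ((s - i - m).factorial : ℂ) = G at *
      generalize ((s - i).factorial : ℂ) = H at *
      rw [eq_div_iff (mul_ne_zero n5 n6)] at hc
      field_simp
      linear_combination ((1 - τ ^ 2) ^ i * (τ ^ 2) ^ m * s.factorial * F * C) * hc
    · intro k
      rw [integral_prod_mul (fun x : ℝ => (x : ℂ) ^ (2 * k + 1))
        (fun y : ℝ => (1 - (y : ℂ) ^ 2) ^ i * (y : ℂ) ^ (2 * (s - i) - (2 * k + 1))),
        h.integral_ofReal_pow_odd, zero_mul, mul_zero]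
  rw [Finset.sum_congr rfl e2]
  refine Finset.sum_comm' fun i m => ?_
  simp only [Finset.mem_range]
  omega

theorem tsum_zonalTerm_natCast [NeZero p] [NeZero q] (h : IsSphereCoordinateLaw p ν)
    (h' : IsSphereCoordinateLaw q ν') (s : ℕ) {τ : ℂ} (hτ : ‖τ‖ < 1) :
    (∫ w, kernelPow s τ w ∂ν.prod ν') * (1 - τ ^ 2) ^ (-(s + 1 / 2 : ℂ)) =
      ∑' k, zonalTerm p q s (τ ^ 2) k := by
  have ht : ‖τ ^ 2‖ < 1 := by
    rw [norm_pow]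
    exact pow_lt_one₀ (norm_nonneg _) hτ two_ne_zero
  have hβ : 1 - τ ^ 2 ≠ 0 := by
    intro h0
    rw [← sub_eq_zero.1 h0] at ht
    simp at ht
  rw [(summable_norm_zonalTerm p q s ht).of_norm.tsum_prod,
    tsum_eq_sum (s := Finset.range (s + 1)), integral_kernelPow_natCast h h', Finset.sum_mul]
  · refine Finset.sum_congr rfl fun m hm => ?_
    rw [Finset.mem_range] at hm
    rw [(hasSum_zonalTerm_natCast p q (show m ≤ s by omega) ht).tsum_eq, Finset.mul_sum,
      Finset.sum_mul]
    refine Finset.sum_congr rfl fun i hi => ?_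
    rw [Finset.mem_range] at hi
    have e : (1 - τ ^ 2) ^ (-((m : ℂ) + 1 / 2 + (s - m - i : ℕ))) =
        (1 - τ ^ 2) ^ i * (1 - τ ^ 2) ^ (-(s + 1 / 2 : ℂ)) := by
      rw [← Complex.cpow_natCast _ i, ← Complex.cpow_add _ _ hβ, Nat.cast_sub (by omega),
        Nat.cast_sub (by omega)]
      congr 1
      ring
    rw [e]
    ring
  · intro m hm
    rw [Finset.mem_range, not_lt] at hm
    simp [zonalTerm, pochhammerSymbol_neg_natCast_eq_zero (show s < m by omega)]

/-- The double series of the zonal function. -/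
theorem integral_kernelPow_eq_tsum [NeZero p] [NeZero q] (h : IsSphereCoordinateLaw p ν)
    (h' : IsSphereCoordinateLaw q ν') (s : ℂ) {τ : ℂ} (hτ : ‖τ‖ < 1) :
    (∫ w, kernelPow s τ w ∂ν.prod ν') * (1 - τ ^ 2) ^ (-(s + 1 / 2 : ℂ)) =
      ∑' k, zonalTerm p q s (τ ^ 2) k := by
  have := h.isProbabilityMeasure
  have := h'.isProbabilityMeasure
  exact ((hasPolynomialSeries_integral_kernelPow (ν.prod ν')).mul
    hasPolynomialSeries_one_sub_sq_cpow).eq_of_natCast (hasPolynomialSeries_tsum_zonalTerm p q)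
    (fun s τ hτ => tsum_zonalTerm_natCast h h' s hτ) s hτ

end Law

/-- The moments of the Gaussian weight on the half-line. -/
def halfGaussianMoment (n : ℕ) : ℝ := ∫ r in Set.Ioi (0 : ℝ), r ^ n * Real.exp (-r ^ 2)

theorem halfGaussianMoment_eq (n : ℕ) :
    halfGaussianMoment n = 1 / 2 * Real.Gamma (((n : ℝ) + 1) / 2) := by
  rw [← integral_rpow_mul_exp_neg_rpow (by norm_num)
    (lt_of_lt_of_le (by norm_num : (-1 : ℝ) < 0) n.cast_nonneg), halfGaussianMoment]
  simp only [Real.rpow_natCast, Real.rpow_ofNat]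

theorem halfGaussianMoment_pos (n : ℕ) : 0 < halfGaussianMoment n := by
  rw [halfGaussianMoment_eq]
  have := Real.Gamma_pos_of_pos (show (0 : ℝ) < ((n : ℝ) + 1) / 2 by positivity)
  positivity

theorem halfGaussianMoment_add_two (n : ℕ) :
    halfGaussianMoment (n + 2) = (n + 1) / 2 * halfGaussianMoment n := by
  rw [halfGaussianMoment_eq, halfGaussianMoment_eq,
    show (((n + 2 : ℕ) : ℝ) + 1) / 2 = ((n : ℝ) + 1) / 2 + 1 by push_cast; ring,
    Real.Gamma_add_one (by positivity)]
  ring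

theorem integral_pow_even_mul_exp_neg_sq (k : ℕ) :
    ∫ x : ℝ, x ^ (2 * k) * Real.exp (-x ^ 2) = 2 * halfGaussianMoment (2 * k) := by
  rw [halfGaussianMoment, ← integral_comp_abs (f := fun x => x ^ (2 * k) * Real.exp (-x ^ 2))]
  simp only [pow_mul, sq_abs]

theorem integral_pow_odd_mul_exp_neg_sq (k : ℕ) :
    ∫ x : ℝ, x ^ (2 * k + 1) * Real.exp (-x ^ 2) = 0 := by
  have h := integral_neg_eq_self (fun x : ℝ => x ^ (2 * k + 1) * Real.exp (-x ^ 2)) volume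
  have e : (fun x : ℝ => (-x) ^ (2 * k + 1) * Real.exp (-(-x) ^ 2)) =
      fun x : ℝ => -(x ^ (2 * k + 1) * Real.exp (-x ^ 2)) := by
    funext x
    rw [neg_sq, Odd.neg_pow ⟨k, rfl⟩, neg_mul]
  rw [e, integral_neg] at h
  linarith

section Sphere

variable (p : ℕ) [NeZero p]

local notation "𝔼" => EuclideanSpace ℝ (Fin p)

theorem integral_coordinate_pow_mul_exp_eq_sphere (n : ℕ) :
    ∫ x : 𝔼, x 0 ^ n * Real.exp (-‖x‖ ^ 2) =
      (∫ θ : Metric.sphere (0 : 𝔼) 1, θ.1 0 ^ n ∂(volume : Measure 𝔼).toSphere) *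
        halfGaussianMoment (p - 1 + n) := by
  have : Nonempty (Fin p) := ⟨0⟩
  calc
    ∫ x : 𝔼, x 0 ^ n * Real.exp (-‖x‖ ^ 2)
      = ∫ x : ({(0)}ᶜ : Set 𝔼), x.1 0 ^ n * Real.exp (-‖x.1‖ ^ 2)
          ∂((volume : Measure 𝔼).comap (↑)) := by
      rw [integral_subtype_comap (measurableSet_singleton _).compl
        fun x : 𝔼 => x 0 ^ n * Real.exp (-‖x‖ ^ 2), restrict_compl_singleton]
    _ = ∫ z, z.1.1 0 ^ n * (z.2.1 ^ n * Real.exp (-z.2.1 ^ 2))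
          ∂(volume : Measure 𝔼).toSphere.prod (.volumeIoiPow (Module.finrank ℝ 𝔼 - 1)) := by
      rw [← (volume : Measure 𝔼).measurePreserving_homeomorphUnitSphereProd.integral_comp
        (Homeomorph.measurableEmbedding _)]
      refine integral_congr_ae (Filter.Eventually.of_forall fun x => ?_)
      have hx : ‖x.1‖ ≠ 0 := norm_ne_zero_iff.2 x.2
      simp only [homeomorphUnitSphereProd_apply_fst_coe, homeomorphUnitSphereProd_apply_snd_coe,
        PiLp.smul_apply, smul_eq_mul]
      rw [← mul_assoc, ← mul_pow]
      field_simp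
    _ = _ := by
      rw [integral_prod_mul (fun θ : Metric.sphere (0 : 𝔼) 1 => θ.1 0 ^ n)
        (fun r : Set.Ioi (0 : ℝ) => r.1 ^ n * Real.exp (-r.1 ^ 2))]
      congr 1
      simp only [Measure.volumeIoiPow, ENNReal.ofReal, finrank_euclideanSpace_fin]
      rw [integral_withDensity_eq_integral_smul
          (measurable_subtype_coe.pow_const _).real_toNNReal,
        integral_subtype_comap measurableSet_Ioi
          fun a : ℝ => Real.toNNReal (a ^ (p - 1)) • (a ^ n * Real.exp (-a ^ 2)),
        halfGaussianMoment]
      refine setIntegral_congr_fun measurableSet_Ioi fun x hx => ?_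
      rw [NNReal.smul_def, Real.coe_toNNReal _ (pow_nonneg (Set.mem_Ioi.1 hx).le _), smul_eq_mul,
        pow_add, mul_assoc]

theorem integral_coordinate_pow_mul_exp_eq_prod (n : ℕ) :
    ∫ x : 𝔼, x 0 ^ n * Real.exp (-‖x‖ ^ 2) =
      (∫ x : ℝ, x ^ n * Real.exp (-x ^ 2)) *
        ∏ _i ∈ Finset.univ.erase (0 : Fin p), ∫ x : ℝ, Real.exp (-x ^ 2) := by
  let f : Fin p → ℝ → ℝ := fun i x => (if i = 0 then x ^ n else 1) * Real.exp (-x ^ 2)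
  have h1 : ∀ x : 𝔼, x 0 ^ n * Real.exp (-‖x‖ ^ 2) = ∏ i, f i (x i) := by
    intro x
    simp only [f, Finset.prod_mul_distrib, Finset.prod_ite_eq', Finset.mem_univ, if_true,
      ← Real.exp_sum, EuclideanSpace.norm_sq_eq, Finset.sum_neg_distrib, Real.norm_eq_abs, sq_abs]
  simp only [h1]
  have h2 := (PiLp.volume_preserving_ofLp (Fin p)).integral_comp
    (MeasurableEquiv.toLp 2 (Fin p → ℝ)).symm.measurableEmbedding
    (fun x : Fin p → ℝ => ∏ i, f i (x i))
  rw [h2, integral_fintype_prod_volume_eq_prod, ← Finset.mul_prod_erase _ _ (Finset.mem_univ 0)]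
  refine congrArg₂ (· * ·) ?_ ?_
  · simp [f]
  · refine Finset.prod_congr rfl fun i hi => ?_
    simp [f, Finset.ne_of_mem_erase hi]

/-- The law of the first coordinate of a uniformly distributed point of the unit sphere. -/
def sphereLaw : Measure ℝ :=
  ((volume : Measure 𝔼).toSphere Set.univ)⁻¹ •
    (volume : Measure 𝔼).toSphere.map fun θ => θ.1 0

theorem measurable_sphere_coordinate :
    Measurable fun θ : Metric.sphere (0 : 𝔼) 1 => θ.1 0 := by
  fun_prop

theorem isSphereCoordinateLaw_sphereLaw : IsSphereCoordinateLaw p (sphereLaw p) := by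
  have : Nonempty (Fin p) := ⟨0⟩
  set μ := (volume : Measure 𝔼).toSphere
  have hm := measurable_sphere_coordinate p
  have hT : ∀ n : ℕ, ∫ x, x ^ n ∂sphereLaw p = (μ Set.univ)⁻¹.toReal * ∫ θ, θ.1 0 ^ n ∂μ := by
    intro n
    rw [sphereLaw, integral_smul_measure, integral_map hm.aemeasurable (by fun_prop), smul_eq_mul]
  have key : ∀ n : ℕ, (∫ θ, θ.1 0 ^ n ∂μ) * halfGaussianMoment (p - 1 + n) =
      (∫ x : ℝ, x ^ n * Real.exp (-x ^ 2)) *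
        ∏ _i ∈ Finset.univ.erase (0 : Fin p), ∫ x : ℝ, Real.exp (-x ^ 2) := fun n => by
    rw [← integral_coordinate_pow_mul_exp_eq_prod, integral_coordinate_pow_mul_exp_eq_sphere]
  refine ⟨⟨?_⟩, ?_, fun k => ?_, fun k => ?_⟩
  · rw [sphereLaw, Measure.smul_apply, Measure.map_apply hm .univ, Set.preimage_univ, smul_eq_mul]
    exact ENNReal.inv_mul_cancel (Measure.measure_univ_ne_zero.2 (Measure.toSphere_ne_zero _))
      (measure_ne_top _ _)
  · refine Measure.ae_smul_measure ?_ _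
    refine (ae_map_iff hm.aemeasurable (p := fun x : ℝ => x ∈ Set.Icc (-1 : ℝ) 1)
      measurableSet_Icc).2 (Filter.Eventually.of_forall fun θ => ?_)
    have h1 := PiLp.norm_apply_le θ.1 0
    rw [norm_eq_of_mem_sphere θ] at h1
    exact abs_le.1 h1
  · have h := key (2 * k + 1)
    rw [integral_pow_odd_mul_exp_neg_sq, zero_mul] at h
    rw [hT, (mul_eq_zero.1 h).resolve_right (halfGaussianMoment_pos _).ne', mul_zero]
  · have h0 := key (2 * k)
    have h1 := key (2 * (k + 1))
    have hp : 1 ≤ p := Nat.one_le_iff_ne_zero.2 (NeZero.ne p)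
    rw [integral_pow_even_mul_exp_neg_sq] at h0 h1
    rw [show p - 1 + 2 * (k + 1) = p - 1 + 2 * k + 2 by ring, mul_add, mul_one,
      halfGaussianMoment_add_two, halfGaussianMoment_add_two] at h1
    rw [hT, hT]
    push_cast [Nat.cast_sub hp] at h1
    have hR := (halfGaussianMoment_pos (p - 1 + 2 * k)).ne'
    refine mul_right_cancel₀ hR ?_
    rw [mul_add 2 k 1, mul_one]
    linear_combination (2 * (μ Set.univ)⁻¹.toReal) * h1 -
      ((2 * k + 1) * (μ Set.univ)⁻¹.toReal) * h0

end Sphere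

theorem continuous_one_sub_sq_rpow {e : ℝ} (he : 0 ≤ e) :
    Continuous fun x : ℝ => (1 - x ^ 2) ^ e := by
  exact Continuous.rpow_const (by fun_prop) fun _ => Or.inr he

theorem integral_pow_odd_mul_one_sub_sq_rpow (e : ℝ) (k : ℕ) :
    ∫ x in (-1 : ℝ)..1, x ^ (2 * k + 1) * (1 - x ^ 2) ^ e = 0 := by
  have h := intervalIntegral.integral_comp_neg (a := -1) (b := 1)
    fun x : ℝ => x ^ (2 * k + 1) * (1 - x ^ 2) ^ e
  have e1 : (fun x : ℝ => (-x) ^ (2 * k + 1) * (1 - (-x) ^ 2) ^ e) =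
      fun x : ℝ => -(x ^ (2 * k + 1) * (1 - x ^ 2) ^ e) := by
    funext x
    rw [neg_sq, Odd.neg_pow ⟨k, rfl⟩, neg_mul]
  rw [e1, intervalIntegral.integral_neg, neg_neg] at h
  linarith

theorem integral_pow_even_mul_one_sub_sq_rpow {e : ℝ} (he : 0 ≤ e) (k : ℕ) :
    (2 * k + (2 * e + 3)) * ∫ x in (-1 : ℝ)..1, x ^ (2 * (k + 1)) * (1 - x ^ 2) ^ e =
      (2 * k + 1) * ∫ x in (-1 : ℝ)..1, x ^ (2 * k) * (1 - x ^ 2) ^ e := by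
  have hc := continuous_one_sub_sq_rpow he
  have hd : ∀ x ∈ Set.uIcc (-1 : ℝ) 1, HasDerivAt (fun x : ℝ => x ^ (2 * k + 1) *
      (1 - x ^ 2) ^ (e + 1)) ((2 * k + 1) * (x ^ (2 * k) * (1 - x ^ 2) ^ e) -
        (2 * k + (2 * e + 3)) * (x ^ (2 * (k + 1)) * (1 - x ^ 2) ^ e)) x := by
    intro x hx
    rw [Set.uIcc_of_le (by norm_num)] at hx
    have h0 : 0 ≤ 1 - x ^ 2 := by nlinarith [hx.1, hx.2]
    have h1 : HasDerivAt (fun x : ℝ => 1 - x ^ 2) (-(2 * x)) x := by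
      simpa using (hasDerivAt_pow 2 x).const_sub 1
    have h2 := (hasDerivAt_pow (2 * k + 1) x).mul (h1.rpow_const (p := e + 1) (Or.inr (by linarith)))
    refine h2.congr_deriv ?_
    rw [add_sub_cancel_right, Real.rpow_add_one' h0 (by linarith), Nat.add_sub_cancel]
    push_cast
    ring
  have h := intervalIntegral.integral_eq_sub_of_hasDerivAt hd
    (Continuous.intervalIntegrable (by fun_prop) _ _)
  rw [intervalIntegral.integral_sub (Continuous.intervalIntegrable (by fun_prop) _ _)
    (Continuous.intervalIntegrable (by fun_prop) _ _), intervalIntegral.integral_const_mul,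
    intervalIntegral.integral_const_mul] at h
  have hz : (0 : ℝ) ^ (e + 1) = 0 := Real.zero_rpow (by linarith)
  norm_num [hz] at h
  linarith

theorem integral_one_sub_sq_rpow_add_one {e : ℝ} (he : 0 ≤ e) :
    (2 * e + 3) * ∫ x in (-1 : ℝ)..1, (1 - x ^ 2) ^ (e + 1) =
      (2 * e + 2) * ∫ x in (-1 : ℝ)..1, (1 - x ^ 2) ^ e := by
  have hc := continuous_one_sub_sq_rpow he
  have h := integral_pow_even_mul_one_sub_sq_rpow he 0
  have h1 : ∫ x in (-1 : ℝ)..1, (1 - x ^ 2) ^ (e + 1) =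
      (∫ x in (-1 : ℝ)..1, (1 - x ^ 2) ^ e) - ∫ x in (-1 : ℝ)..1, x ^ 2 * (1 - x ^ 2) ^ e := by
    rw [← intervalIntegral.integral_sub (Continuous.intervalIntegrable (by fun_prop) _ _)
      (Continuous.intervalIntegrable (by fun_prop) _ _)]
    refine intervalIntegral.integral_congr fun x hx => ?_
    rw [Set.uIcc_of_le (by norm_num)] at hx
    have h0 : 0 ≤ 1 - x ^ 2 := by nlinarith [hx.1, hx.2]
    rw [Real.rpow_add_one' h0 (by linarith)]
    ring
  norm_num at h
  rw [h1]
  linarith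

theorem integral_one_sub_sq_rpow_half (n : ℕ) :
    (∫ x in (-1 : ℝ)..1, (1 - x ^ 2) ^ ((n : ℝ) / 2)) * Real.Gamma ((n + 3) / 2) =
      √Real.pi * Real.Gamma ((n + 2) / 2) := by
  have h32 : Real.Gamma (3 / 2) = √Real.pi / 2 := by
    rw [show (3 / 2 : ℝ) = 1 / 2 + 1 by norm_num, Real.Gamma_add_one (by norm_num),
      Real.Gamma_one_half_eq]
    ring
  induction n using Nat.twoStepInduction with
  | zero =>
    norm_num [h32]
    ring
  | one =>
    simp only [← Real.sqrt_eq_rpow, Nat.cast_one, integral_sqrt_one_sub_sq]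
    norm_num [h32]
    nlinarith [Real.mul_self_sqrt Real.pi_pos.le]
  | more n ih _ =>
    have h := integral_one_sub_sq_rpow_add_one (e := (n : ℝ) / 2) (by positivity)
    rw [show ((n + 2 : ℕ) : ℝ) / 2 = (n : ℝ) / 2 + 1 by push_cast; ring,
      show (((n + 2 : ℕ) : ℝ) + 3) / 2 = ((n : ℝ) + 3) / 2 + 1 by push_cast; ring,
      show (((n + 2 : ℕ) : ℝ) + 2) / 2 = ((n : ℝ) + 2) / 2 + 1 by push_cast; ring,
      Real.Gamma_add_one (by positivity), Real.Gamma_add_one (by positivity)]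
    linear_combination (Real.Gamma (((n : ℝ) + 3) / 2) / 2) * h + ((n : ℝ) + 2) / 2 * ih

/-- The density of the law of a coordinate on the sphere of `ℝ^p`, up to normalization `c`. -/
def densityLaw (c e : ℝ) : Measure ℝ :=
  (volume.restrict (Set.Ioc (-1 : ℝ) 1)).withDensity fun x => ENNReal.ofReal (c * (1 - x ^ 2) ^ e)

theorem integral_densityLaw {c e : ℝ} (hc : 0 ≤ c) {E : Type*} [NormedAddCommGroup E]
    [NormedSpace ℝ E] (f : ℝ → E) :
    ∫ x, f x ∂densityLaw c e = c • ∫ x in (-1 : ℝ)..1, ((1 - x ^ 2) ^ e) • f x := by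
  rw [densityLaw, integral_withDensity_eq_integral_toReal_smul (by fun_prop) (by simp),
    intervalIntegral.integral_of_le (by norm_num), ← integral_smul]
  refine setIntegral_congr_fun measurableSet_Ioc fun x hx => ?_
  have h0 : 0 ≤ 1 - x ^ 2 := by nlinarith [hx.1, hx.2]
  rw [ENNReal.toReal_ofReal (mul_nonneg hc (Real.rpow_nonneg h0 _)), mul_smul]

/-- The normalization constant of the density of the law of a coordinate. -/
def densityConstant (p : ℕ) : ℝ :=
  Real.Gamma (p / 2) / (√Real.pi * Real.Gamma (((p : ℝ) - 1) / 2))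

theorem densityConstant_pos {p : ℕ} (hp : 3 ≤ p) : 0 < densityConstant p := by
  have hp' : (3 : ℝ) ≤ p := by exact_mod_cast hp
  have h1 := Real.Gamma_pos_of_pos (show (0 : ℝ) < p / 2 by linarith)
  have h2 := Real.Gamma_pos_of_pos (show (0 : ℝ) < ((p : ℝ) - 1) / 2 by linarith)
  have := Real.pi_pos
  unfold densityConstant
  positivity

theorem densityConstant_mul_integral {p : ℕ} (hp : 3 ≤ p) :
    densityConstant p * ∫ x in (-1 : ℝ)..1, (1 - x ^ 2) ^ (((p : ℝ) - 3) / 2) = 1 := by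
  obtain ⟨n, rfl⟩ := Nat.exists_eq_add_of_le hp
  have h := integral_one_sub_sq_rpow_half n
  have h2 := Real.Gamma_pos_of_pos (show (0 : ℝ) < ((n : ℝ) + 2) / 2 by positivity)
  have h3 := Real.sqrt_pos.2 Real.pi_pos
  rw [densityConstant]
  push_cast
  rw [show (3 + (n : ℝ) - 3) / 2 = n / 2 by ring, show (3 + (n : ℝ)) / 2 = (n + 3) / 2 by ring,
    show (3 + (n : ℝ) - 1) / 2 = (n + 2) / 2 by ring, div_mul_eq_mul_div, mul_comm, h,
    mul_div_assoc]
  rw [← mul_div_assoc, div_self (by positivity)]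

theorem isSphereCoordinateLaw_densityLaw {p : ℕ} (hp : 3 ≤ p) :
    IsSphereCoordinateLaw p (densityLaw (densityConstant p) (((p : ℝ) - 3) / 2)) := by
  have hp' : (3 : ℝ) ≤ p := by exact_mod_cast hp
  have hc := densityConstant_pos hp
  have he : (0 : ℝ) ≤ ((p : ℝ) - 3) / 2 := by linarith
  have hint := continuous_one_sub_sq_rpow he
  refine ⟨⟨?_⟩, ?_, fun k => ?_, fun k => ?_⟩
  · rw [densityLaw, withDensity_apply _ .univ, Measure.restrict_univ,
      ← ofReal_integral_eq_lintegral_ofReal, ← intervalIntegral.integral_of_le (by norm_num),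
      intervalIntegral.integral_const_mul, densityConstant_mul_integral hp, ENNReal.ofReal_one]
    · exact (Continuous.intervalIntegrable (by fun_prop) _ _).1
    · filter_upwards [ae_restrict_mem measurableSet_Ioc] with x hx
      have h0 : 0 ≤ 1 - x ^ 2 := by nlinarith [hx.1, hx.2]
      exact mul_nonneg hc.le (Real.rpow_nonneg h0 _)
  · refine (withDensity_absolutelyContinuous _ _).ae_le ?_
    filter_upwards [ae_restrict_mem measurableSet_Ioc] with x hx using Set.Ioc_subset_Icc_self hx
  · rw [integral_densityLaw hc.le]
    simp only [smul_eq_mul, mul_comm _ (_ ^ (2 * k + 1))]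
    rw [integral_pow_odd_mul_one_sub_sq_rpow, mul_zero]
  · rw [integral_densityLaw hc.le, integral_densityLaw hc.le]
    have h := integral_pow_even_mul_one_sub_sq_rpow he k
    simp only [smul_eq_mul, mul_comm _ (_ ^ (2 * (k + 1))), mul_comm _ (_ ^ (2 * k))]
    rw [show 2 * (((p : ℝ) - 3) / 2) + 3 = p by ring] at h
    linear_combination (densityConstant p) * h

/-- The law of `cos φ` for `φ` uniformly distributed in `[0, 2π]`. -/
def cosLaw : Measure ℝ :=
  ENNReal.ofReal (2 * Real.pi)⁻¹ •
    (volume.restrict (Set.Ioc (0 : ℝ) (2 * Real.pi))).map Real.cos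

theorem integral_cosLaw {f : ℝ → ℂ} (hf : Measurable f) :
    ∫ x, f x ∂cosLaw =
      (((2 * Real.pi)⁻¹ : ℝ) : ℂ) * ∫ φ in (0 : ℝ)..(2 * Real.pi), f (Real.cos φ) := by
  have hpi := Real.pi_pos
  rw [cosLaw, integral_smul_measure, integral_map Real.measurable_cos.aemeasurable
    hf.aestronglyMeasurable, ENNReal.toReal_ofReal (by positivity),
    intervalIntegral.integral_of_le (by positivity), Complex.real_smul]

theorem isSphereCoordinateLaw_cosLaw : IsSphereCoordinateLaw 2 cosLaw := by
  have hpi := Real.pi_pos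
  have hI : ∀ n : ℕ, ∫ x, x ^ n ∂cosLaw =
      (2 * Real.pi)⁻¹ * ∫ φ in (0 : ℝ)..(2 * Real.pi), Real.cos φ ^ n := by
    intro n
    rw [cosLaw, integral_smul_measure, integral_map Real.measurable_cos.aemeasurable
      (by fun_prop), ENNReal.toReal_ofReal (by positivity),
      intervalIntegral.integral_of_le (by positivity), smul_eq_mul]
  have hrec : ∀ n : ℕ, (n + 2) * ∫ φ in (0 : ℝ)..(2 * Real.pi), Real.cos φ ^ (n + 2) =
      (n + 1) * ∫ φ in (0 : ℝ)..(2 * Real.pi), Real.cos φ ^ n := by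
    intro n
    rw [integral_cos_pow, Real.sin_two_pi, Real.sin_zero]
    field_simp
    ring
  refine ⟨⟨?_⟩, ?_, fun k => ?_, fun k => ?_⟩
  · rw [cosLaw, Measure.smul_apply, Measure.map_apply Real.measurable_cos .univ, Set.preimage_univ,
      Measure.restrict_apply_univ, Real.volume_Ioc, sub_zero, smul_eq_mul,
      ← ENNReal.ofReal_mul (by positivity), inv_mul_cancel₀ (by positivity), ENNReal.ofReal_one]
  · refine Measure.ae_smul_measure ?_ _
    exact (ae_map_iff Real.measurable_cos.aemeasurable measurableSet_Icc).2
      (Filter.Eventually.of_forall Real.cos_mem_Icc)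
  · rw [hI]
    induction k with
    | zero => simp
    | succ k ih =>
      have h := hrec (2 * k + 1)
      have ih' := (mul_eq_zero.1 ih).resolve_left (by positivity)
      rw [ih', mul_zero] at h
      rw [show 2 * (k + 1) + 1 = 2 * k + 1 + 2 by ring,
        (mul_eq_zero.1 h).resolve_left (by positivity), mul_zero]
  · rw [hI, hI]
    have h := hrec (2 * k)
    push_cast at h ⊢
    rw [mul_add 2 k 1, mul_one]
    linear_combination (2 * Real.pi)⁻¹ * h

theorem ofReal_cpow_eq_sq_cpow {r : ℝ} (hr : 0 ≤ r) (σ : ℂ) :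
    (r : ℂ) ^ σ = ((r ^ 2 : ℝ) : ℂ) ^ (σ / 2) := by
  have harg : (r : ℂ).arg = 0 := Complex.arg_ofReal_of_nonneg hr
  have h := Complex.cpow_nat_mul' (x := (r : ℂ)) (n := 2) (by simp [harg, Real.pi_pos])
    (by simp [harg, Real.pi_pos.le]) (σ / 2)
  rw [Complex.ofReal_pow, ← h]
  congr 1
  push_cast
  ring

theorem norm_sq_hyperbolicRotation_symm_fst (p q : ℕ) [NeZero p] [NeZero q] (α : ℝ)
    (u : EuclideanSpace ℝ (Fin q)) (v : EuclideanSpace ℝ (Fin p)) (hu : ‖u‖ = 1) :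
    ‖((hyperbolicRotation p q α).symm (u, v)).1‖ ^ 2 = zonalKernel α (v 0) (u 0) := by
  change ‖u + EuclideanSpace.single 0 ((Real.cosh α - 1) * u 0 - Real.sinh α * v 0)‖ ^ 2 = _
  rw [norm_add_sq_real, EuclideanSpace.inner_single_right, PiLp.norm_single, hu,
    Real.norm_eq_abs, sq_abs, zonalKernel]
  have h := Real.cosh_sq α
  simp only [conj_trivial]
  linear_combination (u 0) ^ 2 * h

theorem measurable_zonalKernel_cpow (α : ℝ) (s : ℂ) :
    Measurable fun w : ℝ × ℝ => (zonalKernel α w.2 w.1 : ℂ) ^ s := by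
  have h : Measurable fun w : ℝ × ℝ => (zonalKernel α w.2 w.1 : ℂ) := by
    unfold zonalKernel
    fun_prop
  exact h.pow_const s

theorem zonalFunction_eq_integral (p q : ℕ) [NeZero p] [NeZero q] (σ : ℂ) (α : ℝ) :
    zonalFunction p q σ α =
      ∫ w, (zonalKernel α w.2 w.1 : ℂ) ^ (σ / 2) ∂(sphereLaw q).prod (sphereLaw p) := by
  have : Nonempty (Fin p) := ⟨0⟩
  have : Nonempty (Fin q) := ⟨0⟩
  have hf := measurable_sphere_coordinate q
  have hg := measurable_sphere_coordinate p
  rw [zonalFunction, sectionInner, average_eq, sphereLaw, sphereLaw, Measure.prod_smul_left,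
    Measure.prod_smul_right, integral_smul_measure, integral_smul_measure,
    Measure.map_prod_map _ _ hf hg, integral_map (hf.prodMap hg).aemeasurable
      (measurable_zonalKernel_cpow α _).aestronglyMeasurable,
    ← Set.univ_prod_univ, measureReal_prod_prod, mul_inv, mul_smul, ENNReal.toReal_inv,
    ENNReal.toReal_inv]
  congr 2
  refine integral_congr_ae (Filter.Eventually.of_forall fun k => ?_)
  have h1 : ‖k.1.1‖ = 1 := norm_eq_of_mem_sphere k.1
  have h2 := norm_sq_hyperbolicRotation_symm_fst p q α k.1.1 k.2.1 h1
  simp only [pseudoAction, zonalVector, h1, Complex.ofReal_one, Complex.one_cpow, map_one, mul_one]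
  rw [ofReal_cpow_eq_sq_cpow (norm_nonneg _), h2]
  rfl

theorem zonalKernel_comm (α x y : ℝ) : zonalKernel α x y = zonalKernel α y x := by
  unfold zonalKernel
  ring

theorem zonalFunction_comm (p q : ℕ) [NeZero p] [NeZero q] (σ : ℂ) (α : ℝ) :
    zonalFunction p q σ α = zonalFunction q p σ α := by
  have := (isSphereCoordinateLaw_sphereLaw p).isProbabilityMeasure
  have := (isSphereCoordinateLaw_sphereLaw q).isProbabilityMeasure
  rw [zonalFunction_eq_integral, zonalFunction_eq_integral, ← integral_prod_swap]
  refine integral_congr_ae (Filter.Eventually.of_forall fun w => ?_)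
  simp only [Prod.fst_swap, Prod.snd_swap]
  rw [zonalKernel_comm]

theorem abs_tanh_lt_one (α : ℝ) : |Real.tanh α| < 1 := by
  rw [Real.tanh_eq_sinh_div_cosh, abs_div, abs_of_pos (Real.cosh_pos α),
    div_lt_one (Real.cosh_pos α)]
  refine abs_lt_of_sq_lt_sq ?_ (Real.cosh_pos α).le
  rw [Real.cosh_sq]
  linarith

theorem norm_tanh_lt_one (α : ℝ) : ‖(Real.tanh α : ℂ)‖ < 1 := by
  rw [Complex.norm_real]
  exact abs_tanh_lt_one α

theorem zonalKernel_eq_mul (α : ℝ) {x y : ℝ} (hx : x ∈ Set.Icc (-1 : ℝ) 1)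
    (hy : y ∈ Set.Icc (-1 : ℝ) 1) :
    zonalKernel α x y = (1 - Real.tanh α * kernelRoot 1 (x, y)) *
      (1 - Real.tanh α * kernelRoot (-1) (x, y)) * Real.cosh α ^ 2 := by
  have h1 := kernelRoot_add hx hy
  have h2 := kernelRoot_mul hx hy
  have h3 := Real.cosh_sq α
  have h4 : Real.tanh α * Real.cosh α = Real.sinh α := by
    rw [Real.tanh_eq_sinh_div_cosh, div_mul_cancel₀ _ (Real.cosh_pos α).ne']
  rw [zonalKernel, ← h4]
  rw [← h4] at h3
  linear_combination (Real.tanh α * Real.cosh α ^ 2) * h1 -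
    (Real.tanh α ^ 2 * Real.cosh α ^ 2) * h2 - h3

theorem one_sub_tanh_mul_kernelRoot_pos (α ε : ℝ) (w : ℝ × ℝ) :
    0 < 1 - Real.tanh α * kernelRoot ε w := by
  have h : |Real.tanh α * kernelRoot ε w| < 1 := by
    rw [abs_mul]
    exact (mul_le_of_le_one_right (abs_nonneg _) (abs_kernelRoot_le ε w)).trans_lt
      (abs_tanh_lt_one α)
  linarith [(abs_lt.1 h).2]

theorem zonalKernel_cpow (α : ℝ) {x y : ℝ} (hx : x ∈ Set.Icc (-1 : ℝ) 1)
    (hy : y ∈ Set.Icc (-1 : ℝ) 1) (σ : ℂ) :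
    (zonalKernel α x y : ℂ) ^ (σ / 2) =
      kernelPow (σ / 2) (Real.tanh α) (x, y) * (Real.cosh α : ℂ) ^ σ := by
  have h1 := one_sub_tanh_mul_kernelRoot_pos α 1 (x, y)
  have h2 := one_sub_tanh_mul_kernelRoot_pos α (-1) (x, y)
  rw [ofReal_cpow_eq_sq_cpow (Real.cosh_pos α).le, zonalKernel_eq_mul α hx hy, Complex.ofReal_mul,
    Complex.mul_cpow_ofReal_nonneg (mul_nonneg h1.le h2.le) (sq_nonneg _), Complex.ofReal_mul,
    Complex.mul_cpow_ofReal_nonneg h1.le h2.le, kernelPow]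
  push_cast
  rfl

theorem zonalFunction_eq_kernelPow (p q : ℕ) [NeZero p] [NeZero q] (σ : ℂ) (α : ℝ) :
    zonalFunction p q σ α =
      (∫ w, kernelPow (σ / 2) (Real.tanh α) w ∂(sphereLaw p).prod (sphereLaw q)) *
        (Real.cosh α : ℂ) ^ σ := by
  have hp := isSphereCoordinateLaw_sphereLaw p
  have hq := isSphereCoordinateLaw_sphereLaw q
  have := hp.isProbabilityMeasure
  have := hq.isProbabilityMeasure
  rw [zonalFunction_eq_integral, ← integral_prod_swap, ← integral_mul_const]
  exact integral_congr_ae ((hp.ae_mem_prod hq).mono fun w hw => zonalKernel_cpow α hw.1 hw.2 σ)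

theorem one_sub_tanh_sq_cpow (α : ℝ) (z : ℂ) :
    (1 - (Real.tanh α : ℂ) ^ 2) ^ (-z) = (Real.cosh α : ℂ) ^ (2 * z) := by
  have hc := Real.cosh_pos α
  have e : 1 - Real.tanh α ^ 2 = (Real.cosh α ^ 2)⁻¹ := by
    rw [Real.tanh_eq_sinh_div_cosh]
    field_simp
    linarith [Real.cosh_sq α]
  have e' : (1 - (Real.tanh α : ℂ) ^ 2) = (((Real.cosh α ^ 2 : ℝ) : ℂ))⁻¹ := by
    rw [← Complex.ofReal_inv, ← e]
    push_cast
    ring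
  rw [e', Complex.inv_cpow _ _ (by
    rw [Complex.arg_ofReal_of_nonneg (sq_nonneg _)]
    exact Real.pi_pos.ne), Complex.cpow_neg, inv_inv, ofReal_cpow_eq_sq_cpow hc.le]
  congr 1
  ring

theorem zonalFunction_eq_tsum (p q : ℕ) [NeZero p] [NeZero q] (σ : ℂ) (α : ℝ) :
    zonalFunction p q σ α = 1 / (Real.cosh α : ℂ) *
      ∑' k, zonalTerm p q (σ / 2) ((Real.tanh α : ℂ) ^ 2) k := by
  have hc : (Real.cosh α : ℂ) ≠ 0 := by exact_mod_cast (Real.cosh_pos α).ne'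
  rw [zonalFunction_eq_kernelPow, ← integral_kernelPow_eq_tsum (isSphereCoordinateLaw_sphereLaw p)
    (isSphereCoordinateLaw_sphereLaw q) (σ / 2) (norm_tanh_lt_one α), one_sub_tanh_sq_cpow,
    show 2 * (σ / 2 + 1 / 2) = σ + 1 by ring, Complex.cpow_add _ _ hc, Complex.cpow_one]
  field_simp

theorem norm_tanh_sq_lt_one (α : ℝ) : ‖(Real.tanh α : ℂ) ^ 2‖ < 1 := by
  rw [norm_pow]
  exact pow_lt_one₀ (norm_nonneg _) (norm_tanh_lt_one α) two_ne_zero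

theorem summable_norm_hornTerm_zonal (p q : ℕ) [NeZero q] (σ : ℂ) (α : ℝ) :
    Summable fun n => ‖hornTerm (zonalNum q σ) (zonalDen p q) (tanhSqPoint α) n‖ := by
  simp only [hornTerm_zonal]
  exact (finTwoArrowEquiv ℕ).summable_iff.2
    (summable_norm_zonalTerm p q (σ / 2) (norm_tanh_sq_lt_one α))

theorem hornSeries_zonal (p q : ℕ) (σ : ℂ) (α : ℝ) :
    hornSeries (zonalNum q σ) (zonalDen p q) (tanhSqPoint α) =
      ∑' k, zonalTerm p q (σ / 2) ((Real.tanh α : ℂ) ^ 2) k := by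
  simp only [hornSeries, hornTerm_zonal]
  exact (finTwoArrowEquiv ℕ).tsum_eq (zonalTerm p q (σ / 2) ((Real.tanh α : ℂ) ^ 2))

theorem zonalFunction_eq_hornSeries (p q : ℕ) [NeZero p] [NeZero q] (σ : ℂ) (α : ℝ) :
    zonalFunction p q σ α =
      1 / (Real.cosh α : ℂ) * hornSeries (zonalNum q σ) (zonalDen p q) (tanhSqPoint α) := by
  rw [hornSeries_zonal, zonalFunction_eq_tsum]

theorem tsum_zonalTerm_one (p : ℕ) (s : ℂ) {t : ℂ} (ht : ‖t‖ < 1) :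
    ∑' k, zonalTerm p 1 s t k =
      ordinaryHypergeometric (-s) (1 / 2 - s) ((p : ℂ) / 2) t * (1 - t) ^ (-(s + 1 / 2)) := by
  have h1 := (summable_norm_hypergeometric (-s) (1 / 2 - s) (p / 2) ht).of_norm.hasSum
  have h2 := hasSum_pochhammerSymbol (s + 1 / 2) ht
  have h := (hasSum_mul_prod h1 h2).tsum_eq
  rw [ordinaryHypergeometric_eq_tsum]
  refine Eq.trans ?_ (h.trans ?_)
  · refine tsum_congr fun k => ?_
    have hk := pochhammerSymbol_half_ne_zero 1 (k.1 + k.2)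
    simp only [zonalTerm]
    rw [Nat.cast_one] at hk ⊢
    rw [show (1 : ℂ) - (s + 1 / 2) = 1 / 2 - s by ring, pow_add]
    generalize pochhammerSymbol (1 / 2) (k.1 + k.2) = A at *
    generalize pochhammerSymbol (1 / 2 - s) k.1 = B at *
    generalize pochhammerSymbol (s + 1 / 2) k.2 = C at *
    rw [mul_div_mul_comm, div_mul_div_cancel₀ hk]
    simp only [div_eq_mul_inv, mul_inv]
    ring
  · congr 1
    refine tsum_congr fun n => ?_
    simp only [pochhammerSymbol, smul_eq_mul, div_eq_mul_inv, mul_inv]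
    ring

theorem zonalFunction_one (p : ℕ) [NeZero p] (σ : ℂ) (α : ℝ) :
    zonalFunction p 1 σ α =
      ordinaryHypergeometric (-σ / 2) ((1 - σ) / 2) ((p : ℂ) / 2) ((Real.tanh α : ℂ) ^ 2) *
        (Real.cosh α : ℂ) ^ σ := by
  have hc : (Real.cosh α : ℂ) ≠ 0 := by exact_mod_cast (Real.cosh_pos α).ne'
  rw [zonalFunction_eq_tsum, tsum_zonalTerm_one p _ (norm_tanh_sq_lt_one α), one_sub_tanh_sq_cpow,
    show 2 * (σ / 2 + 1 / 2) = σ + 1 by ring, Complex.cpow_add _ _ hc, Complex.cpow_one,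
    show -(σ / 2) = -σ / 2 by ring, show 1 / 2 - σ / 2 = (1 - σ) / 2 by ring]
  field_simp

theorem integrable_zonalKernel_cpow {p q : ℕ} {ν ν' : Measure ℝ} (h : IsSphereCoordinateLaw p ν)
    (h' : IsSphereCoordinateLaw q ν') (α : ℝ) (σ : ℂ) :
    Integrable (fun w => (zonalKernel α w.2 w.1 : ℂ) ^ (σ / 2)) (ν'.prod ν) := by
  have := h.isProbabilityMeasure
  have := h'.isProbabilityMeasure
  have hc : ContinuousOn (fun w : ℝ × ℝ => (zonalKernel α w.2 w.1 : ℂ) ^ (σ / 2))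
      (Set.Icc (-1 : ℝ) 1 ×ˢ Set.Icc (-1 : ℝ) 1) := by
    refine ContinuousOn.cpow_const ?_ fun w hw => ?_
    · unfold zonalKernel
      fun_prop
    · rw [Complex.ofReal_mem_slitPlane, zonalKernel_eq_mul α hw.2 hw.1]
      have h1 := one_sub_tanh_mul_kernelRoot_pos α 1 (w.2, w.1)
      have h2 := one_sub_tanh_mul_kernelRoot_pos α (-1) (w.2, w.1)
      have h3 := Real.cosh_pos α
      positivity
  obtain ⟨C, hC⟩ := (isCompact_Icc.prod isCompact_Icc).exists_bound_of_continuousOn hc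
  exact Integrable.of_bound (measurable_zonalKernel_cpow α _).aestronglyMeasurable C
    ((h'.ae_mem_prod h).mono fun w hw => hC w hw)

theorem zonalFunction_eq_integral_integral {p q : ℕ} [NeZero p] [NeZero q] {ν ν' : Measure ℝ}
    (h : IsSphereCoordinateLaw p ν) (h' : IsSphereCoordinateLaw q ν') (σ : ℂ) (α : ℝ) :
    zonalFunction p q σ α = ∫ y, ∫ x, (zonalKernel α x y : ℂ) ^ (σ / 2) ∂ν ∂ν' := by
  have := h.isProbabilityMeasure
  have := h'.isProbabilityMeasure
  rw [zonalFunction_eq_integral, (isSphereCoordinateLaw_sphereLaw p).eq h,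
    (isSphereCoordinateLaw_sphereLaw q).eq h',
    integral_prod _ (integrable_zonalKernel_cpow h h' α σ)]

theorem measurable_zonalKernel_cpow_left (α : ℝ) (s : ℂ) (y : ℝ) :
    Measurable fun x : ℝ => (zonalKernel α x y : ℂ) ^ s := by
  have h : Measurable fun x : ℝ => (zonalKernel α x y : ℂ) := by
    unfold zonalKernel
    fun_prop
  exact h.pow_const s

theorem integral_densityLaw_complex {c e : ℝ} (hc : 0 ≤ c) (f : ℝ → ℂ) :
    ∫ x, f x ∂densityLaw c e =
      (c : ℂ) * ∫ x in (-1 : ℝ)..1, f x * (((1 - x ^ 2) ^ e : ℝ) : ℂ) := by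
  rw [integral_densityLaw hc, Complex.real_smul]
  simp only [Complex.real_smul, mul_comm]

theorem zonalFunction_eq_integral_three_le {p q : ℕ} [NeZero p] [NeZero q] (hp : 3 ≤ p)
    (hq : 3 ≤ q) (σ : ℂ) (α : ℝ) :
    zonalFunction p q σ α =
      ((Real.Gamma (p / 2) * Real.Gamma (q / 2) /
        (Real.pi * Real.Gamma ((p - 1) / 2) * Real.Gamma ((q - 1) / 2)) : ℝ) : ℂ) *
      ∫ y in (-1 : ℝ)..1, ∫ x in (-1 : ℝ)..1,
        (zonalKernel α x y : ℂ) ^ (σ / 2) *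
          (((1 - x ^ 2) ^ (((p : ℝ) - 3) / 2) * (1 - y ^ 2) ^ (((q : ℝ) - 3) / 2) : ℝ) : ℂ) := by
  rw [zonalFunction_eq_integral_integral (isSphereCoordinateLaw_densityLaw hp)
    (isSphereCoordinateLaw_densityLaw hq)]
  simp only [integral_densityLaw_complex (densityConstant_pos hp).le,
    integral_densityLaw_complex (densityConstant_pos hq).le, mul_assoc,
    intervalIntegral.integral_const_mul, Complex.ofReal_mul]
  rw [← mul_assoc, ← Complex.ofReal_mul]
  congr 1
  · congr 1
    rw [densityConstant, densityConstant, div_mul_div_comm]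
    congr 1
    · ring
    · linear_combination (Real.Gamma (((p : ℝ) - 1) / 2) * Real.Gamma (((q : ℝ) - 1) / 2)) *
        Real.mul_self_sqrt Real.pi_pos.le
  · refine intervalIntegral.integral_congr fun y _ => ?_
    simp only [← intervalIntegral.integral_mul_const, mul_assoc]

theorem zonalFunction_two_right {p q : ℕ} [NeZero p] [NeZero q] (hp : 3 ≤ p) (hq : q = 2) (σ : ℂ)
    (α : ℝ) :
    zonalFunction p q σ α =
      ((Real.Gamma (p / 2) /
        (2 * Real.pi ^ (3 / 2 : ℝ) * Real.Gamma ((p - 1) / 2)) : ℝ) : ℂ) *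
      ∫ φ in (0 : ℝ)..(2 * Real.pi), ∫ x in (-1 : ℝ)..1,
        (zonalKernel α x (Real.cos φ) : ℂ) ^ (σ / 2) *
          (((1 - x ^ 2) ^ (((p : ℝ) - 3) / 2) : ℝ) : ℂ) := by
  subst hq
  have hm : Measurable fun y : ℝ => ∫ x, (zonalKernel α x y : ℂ) ^ (σ / 2)
      ∂densityLaw (densityConstant p) (((p : ℝ) - 3) / 2) := by
    have := (isSphereCoordinateLaw_densityLaw hp).isProbabilityMeasure
    exact (measurable_zonalKernel_cpow α _).stronglyMeasurable.integral_prod_right.measurable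
  rw [zonalFunction_eq_integral_integral (isSphereCoordinateLaw_densityLaw hp)
    isSphereCoordinateLaw_cosLaw, integral_cosLaw hm]
  simp only [integral_densityLaw_complex (densityConstant_pos hp).le,
    intervalIntegral.integral_const_mul]
  rw [← mul_assoc, ← Complex.ofReal_mul]
  congr 2
  rw [densityConstant, show (3 / 2 : ℝ) = 1 + 1 / 2 by norm_num, Real.rpow_add Real.pi_pos,
    Real.rpow_one, ← Real.sqrt_eq_rpow, inv_mul_eq_div, div_div]
  congr 1
  ring

theorem zonalFunction_two_two {p q : ℕ} [NeZero p] [NeZero q] (hp : p = 2) (hq : q = 2) (σ : ℂ)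
    (α : ℝ) :
    zonalFunction p q σ α =
      ((1 / (4 * Real.pi ^ 2) : ℝ) : ℂ) *
      ∫ φ in (0 : ℝ)..(2 * Real.pi), ∫ χ in (0 : ℝ)..(2 * Real.pi),
        (zonalKernel α (Real.cos χ) (Real.cos φ) : ℂ) ^ (σ / 2) := by
  subst hp hq
  have hm : Measurable fun y : ℝ => ∫ x, (zonalKernel α x y : ℂ) ^ (σ / 2) ∂cosLaw := by
    have := isSphereCoordinateLaw_cosLaw.isProbabilityMeasure
    exact (measurable_zonalKernel_cpow α _).stronglyMeasurable.integral_prod_right.measurable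
  rw [zonalFunction_eq_integral_integral isSphereCoordinateLaw_cosLaw
    isSphereCoordinateLaw_cosLaw, integral_cosLaw hm]
  simp only [integral_cosLaw (measurable_zonalKernel_cpow_left α (σ / 2) _),
    intervalIntegral.integral_const_mul]
  rw [← mul_assoc, ← Complex.ofReal_mul]
  congr 2
  have := Real.pi_pos
  field_simp
  norm_num

end

theorem theorem1 (p q : ℕ) [NeZero p] [NeZero q] (hp : 2 ≤ p) (hq : 1 ≤ q) (σ : ℂ) (α : ℝ) :
    -- integral representations of the zonal function
    (3 ≤ p → 3 ≤ q →
      zonalFunction p q σ α =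
        ((Real.Gamma (p / 2) * Real.Gamma (q / 2) /
          (Real.pi * Real.Gamma ((p - 1) / 2) * Real.Gamma ((q - 1) / 2)) : ℝ) : ℂ) *
        ∫ y in (-1 : ℝ)..1, ∫ x in (-1 : ℝ)..1,
          (zonalKernel α x y : ℂ) ^ (σ / 2) *
            (((1 - x ^ 2) ^ (((p : ℝ) - 3) / 2) * (1 - y ^ 2) ^ (((q : ℝ) - 3) / 2) : ℝ) : ℂ)) ∧
    (3 ≤ p → q = 2 →
      zonalFunction p q σ α =
        ((Real.Gamma (p / 2) /
          (2 * Real.pi ^ (3 / 2 : ℝ) * Real.Gamma ((p - 1) / 2)) : ℝ) : ℂ) *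
        ∫ φ in (0 : ℝ)..(2 * Real.pi), ∫ x in (-1 : ℝ)..1,
          (zonalKernel α x (Real.cos φ) : ℂ) ^ (σ / 2) *
            (((1 - x ^ 2) ^ (((p : ℝ) - 3) / 2) : ℝ) : ℂ)) ∧
    (p = 2 → q = 2 →
      zonalFunction p q σ α =
        ((1 / (4 * Real.pi ^ 2) : ℝ) : ℂ) *
        ∫ φ in (0 : ℝ)..(2 * Real.pi), ∫ χ in (0 : ℝ)..(2 * Real.pi),
          (zonalKernel α (Real.cos χ) (Real.cos φ) : ℂ) ^ (σ / 2)) ∧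
    -- the double series converge (absolutely) and represent the zonal function
    Summable (fun n => ‖hornTerm (zonalNum q σ) (zonalDen p q) (tanhSqPoint α) n‖) ∧
    zonalFunction p q σ α =
      1 / (Real.cosh α : ℂ) * hornSeries (zonalNum q σ) (zonalDen p q) (tanhSqPoint α) ∧
    Summable (fun n => ‖hornTerm (zonalNum p σ) (zonalDen q p) (tanhSqPoint α) n‖) ∧
    zonalFunction p q σ α =
      1 / (Real.cosh α : ℂ) * hornSeries (zonalNum p σ) (zonalDen q p) (tanhSqPoint α) ∧
    -- symmetry in `p` and `q`
    zonalFunction p q σ α = zonalFunction q p σ α ∧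
    -- the case `q = 1`
    (q = 1 →
      zonalFunction p q σ α =
        ordinaryHypergeometric (-σ / 2) ((1 - σ) / 2) ((p : ℂ) / 2) ((Real.tanh α : ℂ) ^ 2) *
          (Real.cosh α : ℂ) ^ σ) := by
  refine ⟨fun h3 h3' => zonalFunction_eq_integral_three_le h3 h3' σ α,
    fun h3 h2 => zonalFunction_two_right h3 h2 σ α,
    fun h2 h2' => zonalFunction_two_two h2 h2' σ α,
    summable_norm_hornTerm_zonal p q σ α, zonalFunction_eq_hornSeries p q σ α,
    summable_norm_hornTerm_zonal q p σ α, ?_, zonalFunction_comm p q σ α, ?_⟩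
  · rw [zonalFunction_comm, zonalFunction_eq_hornSeries]
  · rintro rfl
    exact zonalFunction_one p σ α
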